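/- Let $n\ge 0$ be an integer, let $\alpha,\beta\in\mathbb R$ with $\alpha,\beta,\alpha+\beta\notin\mathbb Z$, and let $$P_n^{(\alpha,\beta)}(z)=2^{-n}\sum_{k=0}^n\binom{n+\alpha}{n-k}\binom{n+\beta}{k}(z-1)^k(z+1)^{n-k}$$ be the Jacobi polynomial. It has degree exactly $n$. Let $\mathbb P_m$ be the set of complex polynomials of degree $\le m$ (with $\mathbb P_{-1}$ containing no nonzero polynomial), and $\mathbb P_n^*$ the set of those of degree exactly $n$. Consider locally rectifiable curves of the following types: * $\Gamma_1$: a curve from $1-i0$ to $1+i0$ (so oriented clockwise) lying, except for its endpoints, in $\mathbb C\setminus[-1,+\infty)$; * $\Gamma_{-1}$: a curve from $-1+i0$ to $-1-i0$ (so oriented clockwise) lying, except for its endpoints, in $\mathbb C\setminus(-\infty,1]$; * $\Gamma_\infty$: a curve in $\mathbb C\setminus((-\infty,-1]\cup[1,+\infty))$ from $+i\infty$ to $-i\infty$, that is, coming from infinity through the upper half-plane and going to infinity through the lower half-plane. On such a curve $\gamma$ (without its endpoints) let $w$ be any continuous branch of $(1-t)^\alpha(1+t)^\beta$; integrals over $\gamma$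 are understood as improper integrals at the two ends of $\gamma$, taken independently. Suppose that one of the following holds: $\alpha>-1$ and $\gamma=\Gamma_1$; or $\beta>-1$ and $\gamma=\Gamma_{-1}$; or $2n+\alpha+\beta<0$ and $\gamma=\Gamma_\infty$. Then: 1. For every $q\in\mathbb P_{n-1}$ the integral converges and $$\int_\gamma q(t)\,P_n^{(\alpha,\beta)}(t)\,w(t)\,dt=0 .$$ 2. For every $q\in\mathbb P_n^*$ the integral $\int_\gamma q(t)P_n^{(\alpha,\beta)}(t)w(t)\,dt$ converges and is nonzero, except that in the case $\gamma=\Gamma_\infty$, $-1<2n+\alpha+\beta<0$, it diverges for every $q\in\mathbb P_n^*$. 3. These conditions characterize $P_n^{(\alpha,\beta)}$ up to a constant factor: a polynomial $p$ of degree at most $n$ satisfies $\int_\gamma q(t)p(t)w(t)\,dt=0$ for all $q\in\mathbb P_{n-1}$ if and only if $p=c\,P_n^{(\alpha,\beta)}$ for some $c\in\mathbb C$. -/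

import Mathlib

open Polynomial Filter Topology Set

noncomputable section

namespace JacobiOrth

/-- The Jacobi polynomial with (complex) parameters `α`, `β`,
`2⁻ⁿ ∑ₖ binom (n+α) (n-k) · binom (n+β) k · (z-1)ᵏ (z+1)ⁿ⁻ᵏ`,
where `Ring.choose x k = x (x-1) ⋯ (x-k+1) / k!` is the generalized binomial coefficient. -/
def jacobi (n : ℕ) (α β : ℂ) : ℂ[X] :=
  C ((2 : ℂ)⁻¹ ^ n) * ∑ k ∈ Finset.range (n + 1),
    C (Ring.choose ((n : ℂ) + α) (n - k) * Ring.choose ((n : ℂ) + β) k) *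
      ((X - 1) ^ k * (X + 1) ^ (n - k))

/-- An open-ended curve in `Ω`, parametrized by `(0,1)` and absolutely continuous on every compact
parameter interval. Every locally rectifiable curve, in particular every piecewise `C¹` curve,
has such a parametrization (through its arc length). -/
structure IsCurveIn (Ω : Set ℂ) (γ : ℝ → ℂ) : Prop where
  mapsTo : MapsTo γ (Ioo 0 1) Ω
  absCont : ∀ a b : ℝ, 0 < a → a ≤ b → b < 1 → AbsolutelyContinuousOnInterval γ a b

/-- The curves `Γ₁`: from `1 - i0` to `1 + i0` in `ℂ ∖ [-1, +∞)` (hence clockwise). -/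
structure IsGammaOne (γ : ℝ → ℂ) : Prop where
  curve : IsCurveIn (Complex.ofReal '' Ici (-1))ᶜ γ
  start : Tendsto γ (𝓝[>] 0) (𝓝[{z | z.im < 0}] 1)
  finish : Tendsto γ (𝓝[<] 1) (𝓝[{z | 0 < z.im}] 1)

/-- The curves `Γ₋₁`: from `-1 + i0` to `-1 - i0` in `ℂ ∖ (-∞, 1]` (hence clockwise). -/
structure IsGammaNegOne (γ : ℝ → ℂ) : Prop where
  curve : IsCurveIn (Complex.ofReal '' Iic 1)ᶜ γ
  start : Tendsto γ (𝓝[>] 0) (𝓝[{z | 0 < z.im}] (-1))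
  finish : Tendsto γ (𝓝[<] 1) (𝓝[{z | z.im < 0}] (-1))

/-- The curves `Γ_∞`: from `+i∞` to `-i∞` in `ℂ ∖ ((-∞, -1] ∪ [1, +∞))`. That is, the curve comes
from infinity through the upper half-plane and goes to infinity through the lower one; nothing more
is asked about the directions. -/
structure IsGammaInfty (γ : ℝ → ℂ) : Prop where
  curve : IsCurveIn (Complex.ofReal '' (Iic (-1) ∪ Ici 1))ᶜ γ
  start : Tendsto γ (𝓝[>] 0) (Bornology.cobounded ℂ ⊓ 𝓟 {z | 0 < z.im})
  finish : Tendsto γ (𝓝[<] 1) (Bornology.cobounded ℂ ⊓ 𝓟 {z | z.im < 0})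

/-- `w` is a continuous branch on the open curve `γ` of the multi-valued function
`(1 - z)^α (z + 1)^β = exp (α log (1 - z) + β log (z + 1))`. -/
def IsWeightBranch (α β : ℝ) (γ : ℝ → ℂ) (w : ℂ → ℂ) : Prop :=
  ContinuousOn w (γ '' Ioo 0 1) ∧
    ∀ z ∈ γ '' Ioo 0 1, ∃ u v : ℂ, Complex.exp u = 1 - z ∧ Complex.exp v = z + 1 ∧
      w z = Complex.exp (α * u + β * v)

/-- The contour integral `∫_γ f(t) dt`, improper at both ends, converges to `I`: the integrals over
`[a,b]` tend to `I` as `a → 0⁺` and `b → 1⁻` independently. It agrees with the absolutely convergent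
integral whenever the latter exists. -/
def HasContourIntegral (γ : ℝ → ℂ) (f : ℂ → ℂ) (I : ℂ) : Prop :=
  Tendsto (fun p : ℝ × ℝ => ∫ s in p.1..p.2, f (γ s) * deriv γ s)
    (𝓝[>] (0 : ℝ) ×ˢ 𝓝[<] (1 : ℝ)) (𝓝 I)

/-- `∫_γ q p w dt = 0` for all polynomials `q` of degree at most `n - 1`. -/
def OrthogonalBelow (γ : ℝ → ℂ) (w : ℂ → ℂ) (n : ℕ) (p : ℂ[X]) : Prop :=
  ∀ q : ℂ[X], q.degree < n → HasContourIntegral γ (fun t => q.eval t * p.eval t * w t) 0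

/-- `∫_γ q p w dt` converges and is nonzero for all polynomials `q` of degree exactly `n`. -/
def NonorthogonalAt (γ : ℝ → ℂ) (w : ℂ → ℂ) (n : ℕ) (p : ℂ[X]) : Prop :=
  ∀ q : ℂ[X], q.degree = n →
    ∃ I : ℂ, I ≠ 0 ∧ HasContourIntegral γ (fun t => q.eval t * p.eval t * w t) I

/-- `∫_γ q p w dt` diverges for all polynomials `q` of degree exactly `n`. -/
def DivergentAt (γ : ℝ → ℂ) (w : ℂ → ℂ) (n : ℕ) (p : ℂ[X]) : Prop :=
  ∀ q : ℂ[X], q.degree = n →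
    ¬ ∃ I : ℂ, HasContourIntegral γ (fun t => q.eval t * p.eval t * w t) I

/-- Among the polynomials of degree at most `n`, those orthogonal on `γ` to all polynomials of
degree at most `n - 1` are exactly the constant multiples of `P`. -/
def CharacterizedUpToConstant (γ : ℝ → ℂ) (w : ℂ → ℂ) (n : ℕ) (P : ℂ[X]) : Prop :=
  ∀ p : ℂ[X], p.degree ≤ n → (OrthogonalBelow γ w n p ↔ ∃ c : ℂ, p = C c * P)

end JacobiOrth

end

noncomputable section

namespace JacobiOrth

/-! Write `w` for the weight with exponents `a`, `b`, and `L` for `weightedDeriv a b`, so that `(w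
(1 - z²) R)' = w · L R`. Wherever `w (1 - z²) R` vanishes at both ends of the curve, `w · L R`
integrates to zero. Since `a + b` is not an integer, `L` raises every degree by exactly one, so each
polynomial is `L R + c` for a unique constant `c`, and its integral is `c · J` with `J = ∫ w`. What
remains is to compute `c` algebraically and to show `J ≠ 0`.

Algebra (`exists_reducesTo_mul_jacobi`): the Rodrigues step says that `L` maps `P_n` with parameters
`a + 1`, `b + 1` to a nonzero multiple of `P_{n+1}` with parameters `a`, `b`. Integration by parts
replaces `q P_{n+1}` by a multiple of `(1 - X²) q' P_n`, and multiplication by `1 - X²` carries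
reductions at `(a + 1, b + 1)` to reductions at `(a, b)`, scaling the constant by a nonzero factor.
By induction the constant of `q P_n`, for `deg q ≤ n`, vanishes iff `deg q < n`. Uniqueness of `P_n`
follows by testing the remainder against a Jacobi polynomial of its own degree.

Analysis: `J` is, up to a nonzero factor, the difference of the limits of a primitive of `w` at the
two ends, so no contour deformation is needed. Near `1`, for large exponents, an incomplete beta
integral gives a primitive whose values on the two sides of the cut differ by the factor `exp (2πi(b
+ 1)) ≠ 1`; contiguity relations then lower the exponents (`hasPrimitiveWithJump_one`). The point
`-1` is reached by `z ↦ -z`, and `∞` by a Möbius map. Divergence on `Γ_∞` holds because the boundary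
term is unbounded there. -/

/-! ### The first-order operator behind the Rodrigues formula -/

/-- The polynomial `L R` with `(w (1 - z²) R)' = w · L R` for `w = (1 - z)^a (1 + z)^b`. -/
def weightedDeriv (a b : ℂ) : ℂ[X] →ₗ[ℂ] ℂ[X] where
  toFun R := (1 - X ^ 2) * derivative R + (C (b + 1) * (1 - X) - C (a + 1) * (1 + X)) * R
  map_add' R S := by simp only [map_add]; ring
  map_smul' c R := by simp only [smul_eq_C_mul, derivative_C_mul, RingHom.id_apply]; ring

lemma weightedDeriv_apply (a b : ℂ) (R : ℂ[X]) :
    weightedDeriv a b R =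
      (1 - X ^ 2) * derivative R + (C (b + 1) * (1 - X) - C (a + 1) * (1 + X)) * R := rfl

/-- The top-degree part of the operator is `R ↦ -(X² R' + (a + b + 2) X R)`. Its factor can vanish
only for integral `a + b`. -/
lemma coeff_weightedDeriv_natDegree_succ (a b : ℂ) (R : ℂ[X]) :
    (weightedDeriv a b R).coeff (R.natDegree + 1) =
      -(R.natDegree + a + b + 2) * R.leadingCoeff := by
  have h1 : weightedDeriv a b R = derivative R - X * (X * derivative R) +
      (C (b - a) * R - C (a + b + 2) * (X * R)) := by
    rw [weightedDeriv_apply]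
    simp only [C_add, C_sub, C_1, show (2 : ℂ) = 1 + 1 by norm_num]
    ring
  rw [h1]
  have h2 : R.coeff (R.natDegree + 1) = 0 := coeff_eq_zero_of_natDegree_lt (by omega)
  have h3 : R.coeff (R.natDegree + 1 + 1) = 0 := coeff_eq_zero_of_natDegree_lt (by omega)
  have h4 : (X * derivative R).coeff R.natDegree = R.natDegree * R.leadingCoeff := by
    rcases Nat.eq_zero_or_pos R.natDegree with h | h
    · rw [h]; simp
    · obtain ⟨m, hm⟩ := Nat.exists_eq_succ_of_ne_zero h.ne'
      rw [leadingCoeff, hm, Nat.succ_eq_add_one, coeff_X_mul, coeff_derivative]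
      push_cast; ring
  simp only [coeff_add, coeff_sub, coeff_X_mul, coeff_C_mul, h4, h2, coeff_derivative, h3]
  rw [leadingCoeff]
  ring

lemma natDegree_weightedDeriv_le (a b : ℂ) (R : ℂ[X]) :
    (weightedDeriv a b R).natDegree ≤ R.natDegree + 1 := by
  rw [weightedDeriv_apply]
  refine (natDegree_add_le _ _).trans (max_le ?_ ?_)
  · rcases Nat.eq_zero_or_pos R.natDegree with h | h
    · rw [natDegree_eq_zero.1 h |>.choose_spec.symm]; simp
    · refine natDegree_mul_le.trans ?_
      have h1 : (1 - X ^ 2 : ℂ[X]).natDegree ≤ 2 := by compute_degree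
      have h2 := natDegree_derivative_lt h.ne'
      omega
  · refine natDegree_mul_le.trans ?_
    have h1 : (C (b + 1) * (1 - X) - C (a + 1) * (1 + X) : ℂ[X]).natDegree ≤ 1 := by
      compute_degree
    omega

lemma degree_weightedDeriv {a b : ℂ} (h : ∀ m : ℤ, a + b ≠ m) (R : ℂ[X]) (hR : R ≠ 0) :
    (weightedDeriv a b R).degree = (R.natDegree + 1 : ℕ) := by
  refine degree_eq_of_le_of_coeff_ne_zero
    (degree_le_of_natDegree_le (natDegree_weightedDeriv_le a b R)) ?_
  rw [coeff_weightedDeriv_natDegree_succ]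
  refine mul_ne_zero (neg_ne_zero.2 fun h0 => h (-(R.natDegree + 2)) ?_)
    (leadingCoeff_ne_zero.2 hR)
  push_cast
  linear_combination h0

/-- Raising both exponents by one multiplies the weight by `1 - z²`, so both sides, times `w`, are
the derivative of `w (1 - z²)² R`. -/
lemma one_sub_X_sq_mul_weightedDeriv (a b : ℂ) (R : ℂ[X]) :
    (1 - X ^ 2) * weightedDeriv (a + 1) (b + 1) R = weightedDeriv a b ((1 - X ^ 2) * R) := by
  have h : derivative ((1 - X ^ 2) * R) = (1 - X ^ 2) * derivative R - 2 * X * R := by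
    simp only [derivative_mul, derivative_sub, derivative_one, derivative_X_sq]
    simp only [C_ofNat]
    ring
  rw [weightedDeriv_apply, weightedDeriv_apply, h]
  simp only [C_add, C_1]
  ring

/-- Integration by parts: the product rule for `q · (w (1 - z²) S)`. -/
lemma mul_weightedDeriv (a b : ℂ) (q S : ℂ[X]) :
    q * weightedDeriv a b S = weightedDeriv a b (q * S) - (1 - X ^ 2) * (derivative q * S) := by
  rw [weightedDeriv_apply, weightedDeriv_apply, derivative_mul]
  ring

/-! ### Reduction of polynomials to constants modulo the range of the operator -/

/-- The polynomial `p` is congruent to the constant `c` modulo the range of `weightedDeriv a b`. -/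
def ReducesTo (a b : ℂ) (p : ℂ[X]) (c : ℂ) : Prop :=
  ∃ R, p = weightedDeriv a b R + C c

lemma ReducesTo.sub {a b : ℂ} {p q : ℂ[X]} {c d : ℂ} (hp : ReducesTo a b p c)
    (hq : ReducesTo a b q d) : ReducesTo a b (p - q) (c - d) := by
  obtain ⟨R, rfl⟩ := hp
  obtain ⟨S, rfl⟩ := hq
  exact ⟨R - S, by rw [map_sub, C_sub]; ring⟩

lemma ReducesTo.const_mul {a b : ℂ} {p : ℂ[X]} {c : ℂ} (k : ℂ) (hp : ReducesTo a b p c) :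
    ReducesTo a b (C k * p) (k * c) := by
  obtain ⟨R, rfl⟩ := hp
  exact ⟨C k * R, by rw [← smul_eq_C_mul, ← smul_eq_C_mul, map_smul, smul_eq_C_mul,
    smul_eq_C_mul, C_mul]; ring⟩

lemma reducesTo_weightedDeriv (a b : ℂ) (R : ℂ[X]) : ReducesTo a b (weightedDeriv a b R) 0 :=
  ⟨R, by simp⟩

/-- Eliminate `1 + X` between the images of `1` and `1 + X`. The constant is the ratio of the beta
integrals over `[-1, 1]` with exponents `(a + 1, b + 1)` and `(a, b)`. -/
lemma reducesTo_one_sub_X_sq {a b : ℂ} (h : ∀ m : ℤ, a + b ≠ m) :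
    ReducesTo a b (1 - X ^ 2) (4 * (a + 1) * (b + 1) / ((a + b + 2) * (a + b + 3))) := by
  have h2 : a + b + 2 ≠ 0 := fun h0 => h (-2) (by push_cast; linear_combination h0)
  have h3 : a + b + 3 ≠ 0 := fun h0 => h (-3) (by push_cast; linear_combination h0)
  have e1 : weightedDeriv a b 1 = C (2 * (b + 1)) - C (a + b + 2) * (1 + X) := by
    rw [weightedDeriv_apply]
    simp only [C_add, C_mul, C_1, C_ofNat, derivative_one]
    ring
  have e2 : weightedDeriv a b (1 + X) =
      C (a + b + 3) * (1 - X ^ 2) - C (2 * (a + 1)) * (1 + X) := by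
    rw [weightedDeriv_apply]
    simp only [C_add, C_mul, C_1, C_ofNat, derivative_add, derivative_one, derivative_X]
    ring
  refine ⟨C (1 / (a + b + 3)) * (1 + X) - C (2 * (a + 1) / ((a + b + 2) * (a + b + 3))) * 1, ?_⟩
  rw [map_sub, ← smul_eq_C_mul, ← smul_eq_C_mul, map_smul, map_smul, smul_eq_C_mul,
    smul_eq_C_mul, e1, e2]
  have f1 : C (1 / (a + b + 3)) * C (a + b + 3) = 1 := by
    rw [← C_mul, ← C_1]; congr 1; field_simp
  have f2 : C (1 / (a + b + 3)) * C (2 * (a + 1)) =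
      C (2 * (a + 1) / ((a + b + 2) * (a + b + 3))) * C (a + b + 2) := by
    rw [← C_mul, ← C_mul]; congr 1; field_simp
  have f3 : C (2 * (a + 1) / ((a + b + 2) * (a + b + 3))) * C (2 * (b + 1)) =
      C (4 * (a + 1) * (b + 1) / ((a + b + 2) * (a + b + 3))) := by
    rw [← C_mul]; congr 1; field_simp; ring
  linear_combination -(1 - X ^ 2) * f1 + (1 + X) * f2 + f3

lemma ReducesTo.one_sub_X_sq_mul {a b : ℂ} (h : ∀ m : ℤ, a + b ≠ m) {p : ℂ[X]} {c : ℂ}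
    (hp : ReducesTo (a + 1) (b + 1) p c) :
    ReducesTo a b ((1 - X ^ 2) * p)
      (c * (4 * (a + 1) * (b + 1) / ((a + b + 2) * (a + b + 3)))) := by
  obtain ⟨R, rfl⟩ := hp
  obtain ⟨S, hS⟩ := (reducesTo_one_sub_X_sq h).const_mul c
  refine ⟨(1 - X ^ 2) * R + S, ?_⟩
  rw [mul_add, one_sub_X_sq_mul_weightedDeriv, mul_comm _ (C c), hS, map_add]
  ring

/-! ### Jacobi polynomials -/

lemma succ_mul_choose_succ (x : ℂ) (k : ℕ) :
    ((k : ℂ) + 1) * Ring.choose x (k + 1) = Ring.choose x k * (x - k) := by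
  have h := Ring.choose_smul_choose x (Nat.le_succ k)
  rw [Nat.succ_eq_add_one, Nat.add_sub_cancel_left, Ring.choose_one_right,
    Nat.choose_succ_self_right, nsmul_eq_mul] at h
  rw [← h]; push_cast; ring

/-- As `1 - X² = -(X - 1)(X + 1)`, products of powers of `X - 1` and `X + 1` have two-term images;
this suits the sum defining `jacobi`. -/
lemma weightedDeriv_pow_mul_pow (a b : ℂ) (k l : ℕ) :
    weightedDeriv a b ((X - 1) ^ k * (X + 1) ^ l) =
      -(C (k + a + 1) * ((X - 1) ^ k * (X + 1) ^ (l + 1))) -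
        C (l + b + 1) * ((X - 1) ^ (k + 1) * (X + 1) ^ l) := by
  have hk : (X - 1 : ℂ[X]) * derivative ((X - 1) ^ k) = C (k : ℂ) * (X - 1) ^ k := by
    cases k with
    | zero => simp
    | succ k =>
      rw [derivative_pow_succ]
      simp only [derivative_sub, derivative_X, derivative_one, Nat.cast_succ]
      rw [C_add]; simp only [C_1]; ring
  have hl : (X + 1 : ℂ[X]) * derivative ((X + 1) ^ l) = C (l : ℂ) * (X + 1) ^ l := by
    cases l with
    | zero => simp
    | succ k =>
      rw [derivative_pow_succ]
      simp only [derivative_add, derivative_X, derivative_one, Nat.cast_succ]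
      rw [C_add]; simp only [C_1]; ring
  rw [weightedDeriv_apply, derivative_mul]
  simp only [C_add, C_1] at hk hl ⊢
  linear_combination (-(X + 1) * (X + 1) ^ l) * hk - ((X - 1) * (X - 1) ^ k) * hl

lemma jacobi_zero (a b : ℂ) : jacobi 0 a b = 1 := by
  simp [jacobi]

/-- One step of the Rodrigues formula. -/
lemma weightedDeriv_jacobi (n : ℕ) (a b : ℂ) :
    weightedDeriv a b (jacobi n (a + 1) (b + 1)) = C (-2 * ((n : ℂ) + 1)) * jacobi (n + 1) a b := by
  have e1 : (n : ℂ) + (a + 1) = ((n + 1 : ℕ) : ℂ) + a := by push_cast; ring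
  have e2 : (n : ℂ) + (b + 1) = ((n + 1 : ℕ) : ℂ) + b := by push_cast; ring
  unfold jacobi
  rw [e1, e2, ← smul_eq_C_mul, map_smul, map_sum, smul_eq_C_mul]
  set A : ℂ := ((n + 1 : ℕ) : ℂ) + a with hA
  set B : ℂ := ((n + 1 : ℕ) : ℂ) + b with hB
  set T : ℕ → ℂ[X] := fun k => C (Ring.choose A (n + 1 - k) * Ring.choose B k) *
    ((X - 1) ^ k * (X + 1) ^ (n + 1 - k)) with hT
  have hterm : ∀ k ∈ Finset.range (n + 1),
      weightedDeriv a b (C (Ring.choose A (n - k) * Ring.choose B k) *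
        ((X - 1) ^ k * (X + 1) ^ (n - k))) =
      -(C ((n : ℂ) + 1 - k) * T k) - C ((k + 1 : ℕ) : ℂ) * T (k + 1) := by
    intro k hk
    obtain ⟨l, rfl⟩ := Nat.exists_eq_add_of_le (Nat.lt_succ_iff.1 (Finset.mem_range.1 hk))
    rw [← smul_eq_C_mul, map_smul, smul_eq_C_mul, weightedDeriv_pow_mul_pow]
    simp only [hT]
    rw [show k + l - k = l by omega, show k + l + 1 - k = l + 1 by omega,
      show k + l + 1 - (k + 1) = l by omega]
    have c1 := succ_mul_choose_succ A l
    have c2 := succ_mul_choose_succ B k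
    have d1 : C (Ring.choose A l * Ring.choose B k) * C (k + a + 1) =
        C (((k + l : ℕ) : ℂ) + 1 - k) * C (Ring.choose A (l + 1) * Ring.choose B k) := by
      rw [← C_mul, ← C_mul]
      congr 1
      push_cast at hA ⊢
      linear_combination (-Ring.choose B k) * c1 - Ring.choose A l * Ring.choose B k * hA
    have d2 : C (Ring.choose A l * Ring.choose B k) * C (l + b + 1) =
        C ((k + 1 : ℕ) : ℂ) * C (Ring.choose A l * Ring.choose B (k + 1)) := by
      rw [← C_mul, ← C_mul]
      congr 1
      push_cast at hB ⊢
      linear_combination (-Ring.choose A l) * c2 - Ring.choose A l * Ring.choose B k * hB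
    linear_combination (-((X - 1) ^ k * (X + 1) ^ (l + 1))) * d1 -
      ((X - 1) ^ (k + 1) * (X + 1) ^ l) * d2
  rw [Finset.sum_congr rfl hterm, Finset.sum_sub_distrib, Finset.sum_neg_distrib]
  -- Both sums extend to `0 ≤ k ≤ n + 1` because the added terms have coefficient zero; the weights
  -- `n + 1 - k` and `k` then add up to `n + 1`.
  have s1 : ∑ k ∈ Finset.range (n + 1), C ((n : ℂ) + 1 - k) * T k =
      ∑ k ∈ Finset.range (n + 1 + 1), C ((n : ℂ) + 1 - k) * T k := by
    rw [Finset.sum_range_succ _ (n + 1)]; simp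
  have s2 : ∑ k ∈ Finset.range (n + 1), C ((k + 1 : ℕ) : ℂ) * T (k + 1) =
      ∑ k ∈ Finset.range (n + 1 + 1), C (k : ℂ) * T k := by
    rw [Finset.sum_range_succ' _ (n + 1)]; simp
  rw [s1, s2, ← Finset.sum_neg_distrib, ← Finset.sum_sub_distrib, Finset.mul_sum, Finset.mul_sum,
    Finset.mul_sum]
  refine Finset.sum_congr rfl fun k _ => ?_
  have e : C ((2 : ℂ)⁻¹ ^ n) * (-C ((n : ℂ) + 1 - k) - C (k : ℂ)) =
      C (-2 * ((n : ℂ) + 1)) * C (2⁻¹ ^ (n + 1)) := by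
    rw [← C_neg, ← C_sub, ← C_mul, ← C_mul]
    congr 1
    rw [pow_succ]; ring
  linear_combination T k * e

lemma add_one_add_add_one_ne {a b : ℂ} (h : ∀ m : ℤ, a + b ≠ m) (m : ℤ) :
    a + 1 + (b + 1) ≠ m := fun h0 => h (m - 2) (by push_cast; linear_combination h0)

lemma degree_jacobi (n : ℕ) {a b : ℂ} (h : ∀ m : ℤ, a + b ≠ m) : (jacobi n a b).degree = n := by
  induction n generalizing a b with
  | zero => simp [jacobi_zero]
  | succ n ih =>
    have h1 := ih (add_one_add_add_one_ne h)
    have h0 : jacobi n (a + 1) (b + 1) ≠ 0 := by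
      intro h0; rw [h0, degree_zero] at h1; exact absurd h1.symm (WithBot.natCast_ne_bot n)
    have h2 := degree_weightedDeriv h _ h0
    rw [weightedDeriv_jacobi, degree_C_mul (mul_ne_zero (by norm_num) (Nat.cast_add_one_ne_zero n)),
      natDegree_eq_of_degree_eq_some h1] at h2
    exact h2

/-- The algebraic form of orthogonality. -/
lemma exists_reducesTo_mul_jacobi (n : ℕ) {a b : ℂ} (ha : ∀ m : ℤ, a ≠ m) (hb : ∀ m : ℤ, b ≠ m)
    (h : ∀ m : ℤ, a + b ≠ m) (q : ℂ[X]) (hq : q.degree ≤ n) :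
    ∃ c, ReducesTo a b (q * jacobi n a b) c ∧ (c = 0 ↔ q.degree < n) := by
  induction n generalizing a b q with
  | zero =>
    obtain ⟨c, rfl⟩ : ∃ c, q = C c := ⟨_, eq_C_of_degree_le_zero (by simpa using hq)⟩
    refine ⟨c, ⟨0, by simp [jacobi_zero]⟩, ?_⟩
    rw [Nat.cast_zero, ← not_le, ← not_iff_not, not_not]
    constructor
    · intro hc; rw [degree_C hc]
    · intro h0 hc; simp [hc] at h0
  | succ n ih =>
    have hq' : (derivative q).natDegree ≤ n := by
      have h1 := natDegree_derivative_le q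
      have h2 := natDegree_le_of_degree_le hq
      omega
    obtain ⟨c, hc, hc0⟩ := ih (a := a + 1) (b := b + 1)
      (fun m h0 => ha (m - 1) (by push_cast; linear_combination h0))
      (fun m h0 => hb (m - 1) (by push_cast; linear_combination h0))
      (add_one_add_add_one_ne h) (derivative q) (degree_le_of_natDegree_le hq')
    have hn : (-2 * ((n : ℂ) + 1)) ≠ 0 := mul_ne_zero (by norm_num) (Nat.cast_add_one_ne_zero n)
    set κ : ℂ := 4 * (a + 1) * (b + 1) / ((a + b + 2) * (a + b + 3)) with hκ
    have hκ0 : κ ≠ 0 := by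
      refine div_ne_zero (mul_ne_zero (mul_ne_zero (by norm_num) ?_) ?_) (mul_ne_zero ?_ ?_)
      · exact fun h0 => ha (-1) (by push_cast; linear_combination h0)
      · exact fun h0 => hb (-1) (by push_cast; linear_combination h0)
      · exact fun h0 => h (-2) (by push_cast; linear_combination h0)
      · exact fun h0 => h (-3) (by push_cast; linear_combination h0)
    -- Integration by parts: the total derivative contributes `0`, and `q'` times the shifted Jacobi
    -- polynomial contributes `κ c` by induction.
    have key := ((reducesTo_weightedDeriv a b (q * jacobi n (a + 1) (b + 1))).sub
      (hc.one_sub_X_sq_mul h)).const_mul (-2 * ((n : ℂ) + 1))⁻¹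
    rw [← mul_weightedDeriv, weightedDeriv_jacobi] at key
    have e : C (-2 * ((n : ℂ) + 1))⁻¹ * (q * (C (-2 * ((n : ℂ) + 1)) * jacobi (n + 1) a b)) =
        q * jacobi (n + 1) a b := by
      rw [mul_left_comm q, ← mul_assoc, ← C_mul, inv_mul_cancel₀ hn, C_1, one_mul]
    rw [e] at key
    refine ⟨_, key, ?_⟩
    rw [mul_eq_zero, or_iff_right (inv_ne_zero hn), zero_sub, neg_eq_zero, mul_eq_zero,
      or_iff_left hκ0, hc0, degree_lt_iff_coeff_zero, degree_lt_iff_coeff_zero]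
    constructor
    · intro h0 m hm
      obtain ⟨k, rfl⟩ : ∃ k, m = k + 1 := ⟨m - 1, by omega⟩
      have h1 := h0 k (by omega)
      rw [coeff_derivative] at h1
      exact (mul_eq_zero.1 h1).resolve_right (Nat.cast_add_one_ne_zero k)
    · intro h0 m hm
      rw [coeff_derivative, h0 (m + 1) (by omega), zero_mul]

/-! ### The fundamental theorem of calculus along absolutely continuous curves -/

lemma absolutelyContinuousOnInterval_comp {X Y : Type*} [PseudoMetricSpace X]
    [PseudoMetricSpace Y] {g : ℝ → X} {F : X → Y} {K : NNReal} {a b : ℝ}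
    (hg : AbsolutelyContinuousOnInterval g a b) (hF : LipschitzOnWith K F (g '' uIcc a b)) :
    AbsolutelyContinuousOnInterval (F ∘ g) a b := by
  have h0 : Tendsto (fun E : ℕ × (ℕ → ℝ × ℝ) => (K : ℝ) *
      ∑ i ∈ Finset.range E.1, dist (g (E.2 i).1) (g (E.2 i).2))
      (AbsolutelyContinuousOnInterval.totalLengthFilter ⊓
        𝓟 (AbsolutelyContinuousOnInterval.disjWithin a b)) (𝓝 0) := by
    simpa using Tendsto.const_mul (K : ℝ) hg
  refine squeeze_zero' (Eventually.of_forall fun E => Finset.sum_nonneg fun i _ => dist_nonneg)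
    ?_ h0
  refine Eventually.filter_mono inf_le_right (eventually_principal.2 fun E hE => ?_)
  rw [Finset.mul_sum]
  refine Finset.sum_le_sum fun i hi => ?_
  have h := hE.1 i hi
  exact hF.dist_le_mul _ (mem_image_of_mem g h.1) _ (mem_image_of_mem g h.2)

lemma integral_deriv_eq_sub_of_absolutelyContinuous {g : ℝ → ℂ} {a b : ℝ}
    (hg : AbsolutelyContinuousOnInterval g a b) : ∫ s in a..b, deriv g s = g b - g a := by
  have hre : AbsolutelyContinuousOnInterval (Complex.re ∘ g) a b :=
    absolutelyContinuousOnInterval_comp hg (Complex.reCLM.lipschitz.lipschitzOnWith)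
  have him : AbsolutelyContinuousOnInterval (Complex.im ∘ g) a b :=
    absolutelyContinuousOnInterval_comp hg (Complex.imCLM.lipschitz.lipschitzOnWith)
  have hd := hg.boundedVariationOn.ae_differentiableAt_of_mem_uIcc
  have e : ∫ s in a..b, deriv g s = ∫ s in a..b, (((deriv (Complex.re ∘ g) s : ℝ) : ℂ) +
      ((deriv (Complex.im ∘ g) s : ℝ) : ℂ) * Complex.I) := by
    refine intervalIntegral.integral_congr_ae ?_
    filter_upwards [hd] with s hs hsab
    have h := (hs (uIoc_subset_uIcc hsab)).hasDerivAt
    have h1 : deriv (Complex.re ∘ g) s = (deriv g s).re :=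
      (Complex.reCLM.hasFDerivAt.comp_hasDerivAt s h).deriv
    have h2 : deriv (Complex.im ∘ g) s = (deriv g s).im :=
      (Complex.imCLM.hasFDerivAt.comp_hasDerivAt s h).deriv
    rw [h1, h2, Complex.re_add_im]
  have hofReal : ∀ {φ : ℝ → ℝ}, IntervalIntegrable φ MeasureTheory.volume a b →
      IntervalIntegrable (fun s => (φ s : ℂ)) MeasureTheory.volume a b :=
    fun h => ⟨h.1.ofReal, h.2.ofReal⟩
  rw [e, intervalIntegral.integral_add (hofReal hre.intervalIntegrable_deriv)
    ((hofReal him.intervalIntegrable_deriv).mul_const _), intervalIntegral.integral_mul_const,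
    intervalIntegral.integral_ofReal, intervalIntegral.integral_ofReal,
    hre.integral_deriv_eq_sub, him.integral_deriv_eq_sub]
  apply Complex.ext <;> simp

/-- A holomorphic `F` is Lipschitz on the compact trace of the curve, so `F ∘ γ` is absolutely
continuous, and the chain rule holds almost everywhere. -/
lemma integral_comp_mul_deriv_eq_sub {Ω : Set ℂ} (hΩ : IsOpen Ω) {F f : ℂ → ℂ}
    (hF : ∀ z ∈ Ω, HasDerivAt F (f z) z) {γ : ℝ → ℂ} {a b : ℝ}
    (hγ : AbsolutelyContinuousOnInterval γ a b) (hmem : MapsTo γ (uIcc a b) Ω) :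
    ∫ s in a..b, f (γ s) * deriv γ s = F (γ b) - F (γ a) := by
  have hdiff : DifferentiableOn ℂ F Ω := fun z hz =>
    (hF z hz).differentiableAt.differentiableWithinAt
  obtain ⟨K, hK⟩ : ∃ K, LipschitzOnWith K F (γ '' uIcc a b) := by
    refine LocallyLipschitzOn.exists_lipschitzOnWith_of_compact
      (isCompact_uIcc.image_of_continuousOn hγ.continuousOn) ?_
    rintro _ ⟨s, hs, rfl⟩
    obtain ⟨K, t, ht, hKt⟩ := ((hdiff.analyticAt (hΩ.mem_nhds (hmem hs))).contDiffAt
      (n := 1)).exists_lipschitzOnWith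
    exact ⟨K, t, mem_nhdsWithin_of_mem_nhds ht, hKt⟩
  rw [← Function.comp_apply (f := F), ← Function.comp_apply (f := F) (x := a),
    ← integral_deriv_eq_sub_of_absolutelyContinuous (absolutelyContinuousOnInterval_comp hγ hK)]
  refine intervalIntegral.integral_congr_ae ?_
  filter_upwards [hγ.boundedVariationOn.ae_differentiableAt_of_mem_uIcc] with s hs hsab
  have hs' := uIoc_subset_uIcc hsab
  exact ((hF _ (hmem hs')).comp s (hs hs').hasDerivAt).deriv.symm

/-- The partial contour integrals are differences of values of a primitive. -/
lemma IsCurveIn.eventuallyEq_integral {Ω : Set ℂ} {γ : ℝ → ℂ} (hγ : IsCurveIn Ω γ)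
    (hΩ : IsOpen Ω) {F f g : ℂ → ℂ} (hF : ∀ z ∈ Ω, HasDerivAt F (f z) z)
    (hfg : ∀ z ∈ γ '' Ioo 0 1, g z = f z) :
    (fun p : ℝ × ℝ => ∫ s in p.1..p.2, g (γ s) * deriv γ s)
      =ᶠ[𝓝[>] (0 : ℝ) ×ˢ 𝓝[<] (1 : ℝ)] fun p => F (γ p.2) - F (γ p.1) := by
  have h0 : ∀ᶠ x in 𝓝[>] (0 : ℝ), x ∈ Ioo (0 : ℝ) (1 / 2) := Ioo_mem_nhdsGT (by norm_num)
  have h1 : ∀ᶠ x in 𝓝[<] (1 : ℝ), x ∈ Ioo (1 / 2 : ℝ) 1 := Ioo_mem_nhdsLT (by norm_num)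
  filter_upwards [h0.prod_mk h1] with p hp
  obtain ⟨⟨h1, h2⟩, h3, h4⟩ := hp
  have hle : p.1 ≤ p.2 := (h2.trans h3).le
  have hsub : uIcc p.1 p.2 ⊆ Ioo 0 1 := by
    rw [uIcc_of_le hle]
    exact fun x hx => ⟨h1.trans_le hx.1, hx.2.trans_lt h4⟩
  rw [← integral_comp_mul_deriv_eq_sub hΩ hF (hγ.absCont _ _ h1 hle h4)
    (hγ.mapsTo.mono_left hsub)]
  refine intervalIntegral.integral_congr fun s hs => ?_
  simp only [hfg _ (mem_image_of_mem γ (hsub hs))]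

lemma IsCurveIn.hasContourIntegral {Ω : Set ℂ} {γ : ℝ → ℂ} (hγ : IsCurveIn Ω γ)
    (hΩ : IsOpen Ω) {F f g : ℂ → ℂ} (hF : ∀ z ∈ Ω, HasDerivAt F (f z) z)
    (hfg : ∀ z ∈ γ '' Ioo 0 1, g z = f z) {l₀ l₁ : Filter ℂ} (h0 : Tendsto γ (𝓝[>] 0) l₀)
    (h1 : Tendsto γ (𝓝[<] 1) l₁) {A B : ℂ} (hA : Tendsto F l₀ (𝓝 A)) (hB : Tendsto F l₁ (𝓝 B)) :
    HasContourIntegral γ g (B - A) :=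
  (((hB.comp h1).comp tendsto_snd).sub ((hA.comp h0).comp tendsto_fst)).congr'
    (hγ.eventuallyEq_integral hΩ hF hfg).symm

/-- The two ends are independent, so the lower limit can be frozen while the upper one makes the
primitive unbounded; cancellation between the ends cannot help. -/
lemma IsCurveIn.not_hasContourIntegral {Ω : Set ℂ} {γ : ℝ → ℂ} (hγ : IsCurveIn Ω γ)
    (hΩ : IsOpen Ω) {F f g : ℂ → ℂ} (hF : ∀ z ∈ Ω, HasDerivAt F (f z) z)
    (hfg : ∀ z ∈ γ '' Ioo 0 1, g z = f z) {l₁ : Filter ℂ}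
    (h1 : Tendsto γ (𝓝[<] 1) l₁) (hB : Tendsto (fun z => ‖F z‖) l₁ atTop) (I : ℂ) :
    ¬ HasContourIntegral γ g I := by
  intro hI
  have h := Tendsto.congr' (hγ.eventuallyEq_integral hΩ hF hfg) hI
  have hbdd : ∀ᶠ p in 𝓝[>] (0 : ℝ) ×ˢ 𝓝[<] (1 : ℝ),
      ‖F (γ p.2) - F (γ p.1)‖ < ‖I‖ + 1 := h.norm.eventually_lt_const (by linarith)
  obtain ⟨s, hs⟩ := hbdd.curry.exists
  have h2 : ∀ᶠ t in 𝓝[<] (1 : ℝ), ‖I‖ + 1 + ‖F (γ s)‖ < ‖F (γ t)‖ :=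
    (hB.comp h1).eventually_gt_atTop _
  obtain ⟨t, ht1, ht2⟩ := (hs.and h2).exists
  have := norm_sub_norm_le (F (γ t)) (F (γ s))
  linarith

lemma HasContourIntegral.unique {γ : ℝ → ℂ} {f : ℂ → ℂ} {I J : ℂ}
    (hI : HasContourIntegral γ f I) (hJ : HasContourIntegral γ f J) : I = J :=
  tendsto_nhds_unique hI hJ

/-! ### Branches of the weight -/

/-- On the open set `Ω`, the functions `u` and `v` are holomorphic branches of `log (σ (1 - z))` and
`log (τ (1 + z))`, where `σ` and `τ` are signs. -/
structure IsLogPair (Ω : Set ℂ) (σ τ : ℂ) (u v : ℂ → ℂ) : Prop where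
  isOpen : IsOpen Ω
  sq_left : σ ^ 2 = 1
  sq_right : τ ^ 2 = 1
  exp_left : ∀ z ∈ Ω, Complex.exp (u z) = σ * (1 - z)
  exp_right : ∀ z ∈ Ω, Complex.exp (v z) = τ * (1 + z)
  hasDerivAt_left : ∀ z ∈ Ω, HasDerivAt u (-(1 - z)⁻¹) z
  hasDerivAt_right : ∀ z ∈ Ω, HasDerivAt v ((1 + z)⁻¹) z

/-- The branch of `(1 - z)^a (1 + z)^b`, up to a constant factor, given by two logarithms. -/
def weight (u v : ℂ → ℂ) (a b : ℝ) (z : ℂ) : ℂ := Complex.exp (a * u z + b * v z)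

lemma weight_ne_zero (u v : ℂ → ℂ) (a b : ℝ) (z : ℂ) : weight u v a b z ≠ 0 :=
  Complex.exp_ne_zero _

lemma norm_eq_one_of_sq {σ : ℂ} (h : σ ^ 2 = 1) : ‖σ‖ = 1 := by
  have h1 : ‖σ‖ ^ 2 = 1 := by rw [← norm_pow, h, norm_one]
  exact (pow_eq_one_iff_of_nonneg (norm_nonneg σ) two_ne_zero).1 h1

namespace IsLogPair

variable {Ω : Set ℂ} {σ τ : ℂ} {u v : ℂ → ℂ}

lemma one_sub_ne_zero (h : IsLogPair Ω σ τ u v) {z : ℂ} (hz : z ∈ Ω) : 1 - z ≠ 0 := by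
  intro h0
  exact Complex.exp_ne_zero (u z) (by rw [h.exp_left z hz, h0, mul_zero])

lemma one_add_ne_zero (h : IsLogPair Ω σ τ u v) {z : ℂ} (hz : z ∈ Ω) : 1 + z ≠ 0 := by
  intro h0
  exact Complex.exp_ne_zero (v z) (by rw [h.exp_right z hz, h0, mul_zero])

lemma weight_add_one_left (h : IsLogPair Ω σ τ u v) (a b : ℝ) {z : ℂ} (hz : z ∈ Ω) :
    weight u v (a + 1) b z = σ * (1 - z) * weight u v a b z := by
  rw [← h.exp_left z hz, weight, weight, ← Complex.exp_add]
  congr 1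
  push_cast; ring

lemma weight_add_one_right (h : IsLogPair Ω σ τ u v) (a b : ℝ) {z : ℂ} (hz : z ∈ Ω) :
    weight u v a (b + 1) z = τ * (1 + z) * weight u v a b z := by
  rw [← h.exp_right z hz, weight, weight, ← Complex.exp_add]
  congr 1
  push_cast; ring

lemma hasDerivAt_weight (h : IsLogPair Ω σ τ u v) (a b : ℝ) {z : ℂ} (hz : z ∈ Ω) :
    HasDerivAt (weight u v a b)
      (weight u v a b z * (a * -(1 - z)⁻¹ + b * (1 + z)⁻¹)) z :=
  (((h.hasDerivAt_left z hz).const_mul (a : ℂ)).add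
    ((h.hasDerivAt_right z hz).const_mul (b : ℂ))).cexp

lemma hasDerivAt_weight_mul (h : IsLogPair Ω σ τ u v) (a b : ℝ) (R : ℂ[X]) {z : ℂ} (hz : z ∈ Ω) :
    HasDerivAt (fun z => weight u v a b z * ((1 - z ^ 2) * R.eval z))
      (weight u v a b z * (weightedDeriv a b R).eval z) z := by
  have h1 := h.one_sub_ne_zero hz
  have h2 := h.one_add_ne_zero hz
  have hq : HasDerivAt (fun z : ℂ => 1 - z ^ 2) (-(2 * z)) z := by
    simpa using (hasDerivAt_pow 2 z).const_sub 1
  refine ((h.hasDerivAt_weight a b hz).mul (hq.mul (R.hasDerivAt z))).congr_deriv ?_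
  rw [weightedDeriv_apply]
  simp only [eval_add, eval_sub, eval_mul, eval_one, eval_pow, eval_X, eval_C, Pi.mul_apply]
  field_simp
  ring

lemma norm_exp_left (h : IsLogPair Ω σ τ u v) {z : ℂ} (hz : z ∈ Ω) :
    Real.exp (u z).re = ‖1 - z‖ := by
  rw [← Complex.norm_exp, h.exp_left z hz, norm_mul, norm_eq_one_of_sq h.sq_left, one_mul]

lemma norm_exp_right (h : IsLogPair Ω σ τ u v) {z : ℂ} (hz : z ∈ Ω) :
    Real.exp (v z).re = ‖1 + z‖ := by
  rw [← Complex.norm_exp, h.exp_right z hz, norm_mul, norm_eq_one_of_sq h.sq_right, one_mul]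

lemma norm_weight (h : IsLogPair Ω σ τ u v) (a b : ℝ) {z : ℂ} (hz : z ∈ Ω) :
    ‖weight u v a b z‖ = ‖1 - z‖ ^ a * ‖1 + z‖ ^ b := by
  rw [weight, Complex.norm_exp, ← h.norm_exp_left hz, ← h.norm_exp_right hz, ← Real.exp_mul,
    ← Real.exp_mul, ← Real.exp_add]
  congr 1
  simp only [Complex.add_re, Complex.re_ofReal_mul]
  ring

lemma norm_weight_mul (h : IsLogPair Ω σ τ u v) (a b : ℝ) (R : ℂ[X]) {z : ℂ} (hz : z ∈ Ω) :
    ‖weight u v a b z * ((1 - z ^ 2) * R.eval z)‖ =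
      ‖1 - z‖ ^ (a + 1) * ‖1 + z‖ ^ (b + 1) * ‖R.eval z‖ := by
  have h1 : 0 < ‖1 - z‖ := norm_pos_iff.2 (h.one_sub_ne_zero hz)
  have h2 : 0 < ‖1 + z‖ := norm_pos_iff.2 (h.one_add_ne_zero hz)
  rw [norm_mul, norm_mul, h.norm_weight a b hz, show 1 - z ^ 2 = (1 - z) * (1 + z) by ring,
    norm_mul, Real.rpow_add_one h1.ne', Real.rpow_add_one h2.ne']
  ring

/-- A continuous branch of the weight along a curve is a constant multiple of a holomorphic one. -/
lemma exists_eq_const_mul_weight (h : IsLogPair Ω σ τ u v) {γ : ℝ → ℂ} (hγ : IsCurveIn Ω γ)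
    {a b : ℝ} {w : ℂ → ℂ} (hw : IsWeightBranch a b γ w) :
    ∃ k : ℂ, k ≠ 0 ∧ ∀ z ∈ γ '' Ioo 0 1, w z = k * weight u v a b z := by
  have hsub : γ '' Ioo 0 1 ⊆ Ω := hγ.mapsTo.image_subset
  have hγc : ContinuousOn γ (Ioo 0 1) := by
    intro s hs
    have hac := (hγ.absCont (s / 2) ((s + 1) / 2) (by linarith [hs.1])
      (by linarith [hs.1]) (by linarith [hs.2])).continuousOn
    rw [uIcc_of_le (by linarith [hs.1])] at hac
    exact (hac.continuousAt
      (Icc_mem_nhds (by linarith [hs.1]) (by linarith [hs.2]))).continuousWithinAt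
  have hconn : IsPreconnected (γ '' Ioo 0 1) := isPreconnected_Ioo.image γ hγc
  have hcont : ContinuousOn (fun z => w z / weight u v a b z) (γ '' Ioo 0 1) :=
    hw.1.div (fun z hz => (h.hasDerivAt_weight a b (hsub hz)).continuousAt.continuousWithinAt)
      fun z _ => weight_ne_zero u v a b z
  -- Two choices of logarithm differ by multiples of `πi` (not `2πi`, because of the signs `σ`, `τ`,
  -- which doubling removes). So the ratio takes countably many values, and on a connected set it is
  -- constant.
  have hval : (fun z => w z / weight u v a b z) '' (γ '' Ioo 0 1) ⊆
      range (fun m : ℤ × ℤ => Complex.exp (a * (m.1 * (Real.pi * Complex.I)) +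
        b * (m.2 * (Real.pi * Complex.I)))) := by
    rintro _ ⟨z, hz, rfl⟩
    obtain ⟨u', v', hu', hv', hwz⟩ := hw.2 z hz
    have h1 := h.one_sub_ne_zero (hsub hz)
    have h2 := h.one_add_ne_zero (hsub hz)
    have hu : Complex.exp (2 * (u' - u z)) = 1 := by
      rw [two_mul, Complex.exp_add, Complex.exp_sub, hu', h.exp_left z (hsub hz)]
      have := h.sq_left
      have h0 : σ ≠ 0 := by rintro rfl; norm_num at this
      field_simp
      exact this.symm
    have hv : Complex.exp (2 * (v' - v z)) = 1 := by
      rw [two_mul, Complex.exp_add, Complex.exp_sub, hv', h.exp_right z (hsub hz), add_comm z 1]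
      have := h.sq_right
      have h0 : τ ≠ 0 := by rintro rfl; norm_num at this
      field_simp
      exact this.symm
    obtain ⟨m, hm⟩ := Complex.exp_eq_one_iff.1 hu
    obtain ⟨l, hl⟩ := Complex.exp_eq_one_iff.1 hv
    refine ⟨(m, l), ?_⟩
    simp only
    rw [hwz, weight, ← Complex.exp_sub]
    congr 1
    linear_combination (-(a : ℂ) / 2) * hm + (-(b : ℂ) / 2) * hl
  have hsing := (countable_range (fun m : ℤ × ℤ => Complex.exp
    (a * (m.1 * (Real.pi * Complex.I)) + b * (m.2 * (Real.pi * Complex.I))))).isTotallyDisconnected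
    _ hval (hconn.image _ hcont)
  have hz₀ : γ (1 / 2) ∈ γ '' Ioo 0 1 := mem_image_of_mem γ ⟨by norm_num, by norm_num⟩
  refine ⟨w (γ (1 / 2)) / weight u v a b (γ (1 / 2)), ?_, fun z hz => ?_⟩
  · obtain ⟨u', v', -, -, hwz⟩ := hw.2 _ hz₀
    exact div_ne_zero (hwz ▸ Complex.exp_ne_zero _) (weight_ne_zero u v a b _)
  · have e := hsing (mem_image_of_mem _ hz) (mem_image_of_mem _ hz₀)
    beta_reduce at e
    rw [← e, div_mul_cancel₀ _ (weight_ne_zero u v a b z)]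

end IsLogPair

/-! ### Contour integrals of polynomials against the weight -/

/-- The function `f` has a primitive on `Ω` with distinct limits along two filters. -/
def HasPrimitiveWithJump (Ω : Set ℂ) (f : ℂ → ℂ) (l₀ l₁ : Filter ℂ) : Prop :=
  ∃ (F : ℂ → ℂ) (A B : ℂ), (∀ z ∈ Ω, HasDerivAt F (f z) z) ∧ Tendsto F l₀ (𝓝 A) ∧
    Tendsto F l₁ (𝓝 B) ∧ A ≠ B

/-- Below the degree `N`, integration against `w` is, up to the factor `J ≠ 0`, the reduction of
polynomials to constants. -/
def IntegralReduces (γ : ℝ → ℂ) (w : ℂ → ℂ) (a b : ℝ) (N : ℕ) : Prop :=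
  ∃ J : ℂ, J ≠ 0 ∧ ∀ (p : ℂ[X]) (c : ℂ), p.degree < N → ReducesTo a b p c →
    HasContourIntegral γ (fun t => p.eval t * w t) (c * J)

lemma degree_eq_of_eq_weightedDeriv_add_C {a b : ℂ} (h : ∀ m : ℤ, a + b ≠ m) {p R : ℂ[X]} {c : ℂ}
    (hp : p = weightedDeriv a b R + C c) (hR : R ≠ 0) : p.degree = (R.natDegree + 1 : ℕ) := by
  have h1 := degree_weightedDeriv h R hR
  rw [hp, degree_add_eq_left_of_degree_lt, h1]
  refine degree_C_le.trans_lt ?_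
  rw [h1]
  exact_mod_cast Nat.succ_pos _

/-- For `p = L R + c` the integrand has primitive `k (w (1 - z²) R + c F)`; the first part vanishes
at both ends, the second jumps by `k c (B - A)`. Since `deg p = deg R + 1` for `R ≠ 0`, only `R`
with `natDegree + 1 < N` matter. -/
lemma IsLogPair.integralReduces {Ω : Set ℂ} {σ τ : ℂ} {u v : ℂ → ℂ} (h : IsLogPair Ω σ τ u v)
    {γ : ℝ → ℂ} (hγ : IsCurveIn Ω γ) {a b : ℝ} (hab : ∀ m : ℤ, (a : ℂ) + b ≠ m) {w : ℂ → ℂ}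
    (hw : IsWeightBranch a b γ w) {l₀ l₁ : Filter ℂ} (h0 : Tendsto γ (𝓝[>] 0) l₀)
    (h1 : Tendsto γ (𝓝[<] 1) l₁) (hjump : HasPrimitiveWithJump Ω (weight u v a b) l₀ l₁) {N : ℕ}
    (hv₀ : ∀ R : ℂ[X], R.natDegree + 1 < N →
      Tendsto (fun z => weight u v a b z * ((1 - z ^ 2) * R.eval z)) l₀ (𝓝 0))
    (hv₁ : ∀ R : ℂ[X], R.natDegree + 1 < N →
      Tendsto (fun z => weight u v a b z * ((1 - z ^ 2) * R.eval z)) l₁ (𝓝 0)) :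
    IntegralReduces γ w a b N := by
  obtain ⟨F, A, B, hF, hA, hB, hne⟩ := hjump
  obtain ⟨k, hk, hwk⟩ := h.exists_eq_const_mul_weight hγ hw
  refine ⟨k * (B - A), mul_ne_zero hk (sub_ne_zero.2 hne.symm), fun p c hdeg hred => ?_⟩
  obtain ⟨R, hR⟩ := hred
  have hboundary : Tendsto (fun z => weight u v a b z * ((1 - z ^ 2) * R.eval z)) l₀ (𝓝 0) ∧
      Tendsto (fun z => weight u v a b z * ((1 - z ^ 2) * R.eval z)) l₁ (𝓝 0) := by
    rcases eq_or_ne R 0 with rfl | hR0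
    · simp [tendsto_const_nhds]
    · rw [degree_eq_of_eq_weightedDeriv_add_C hab hR hR0] at hdeg
      exact ⟨hv₀ R (by exact_mod_cast hdeg), hv₁ R (by exact_mod_cast hdeg)⟩
  have key := hγ.hasContourIntegral (Ω := Ω)
    (F := fun z => k * (weight u v a b z * ((1 - z ^ 2) * R.eval z) + c * F z))
    (f := fun z => k * (weight u v a b z * (weightedDeriv a b R).eval z + c * weight u v a b z))
    (g := fun t => p.eval t * w t) h.isOpen
    (fun z hz => ((h.hasDerivAt_weight_mul a b R hz).add ((hF z hz).const_mul c)).const_mul k)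
    (fun z hz => by
      rw [hwk z hz, hR, eval_add, eval_C]; ring) h0 h1
    ((hboundary.1.add (hA.const_mul c)).const_mul k)
    ((hboundary.2.add (hB.const_mul c)).const_mul k)
  convert key using 1
  ring

lemma IntegralReduces.exists_integral {γ : ℝ → ℂ} {w : ℂ → ℂ} {a b : ℝ} {N n : ℕ}
    (h : IntegralReduces γ w a b N) (ha : ∀ m : ℤ, (a : ℂ) ≠ m) (hb : ∀ m : ℤ, (b : ℂ) ≠ m)
    (hab : ∀ m : ℤ, (a : ℂ) + b ≠ m) (q : ℂ[X]) (hq : q.degree ≤ n)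
    (hN : (q * jacobi n a b).degree < N) :
    ∃ I, HasContourIntegral γ (fun t => q.eval t * (jacobi n a b).eval t * w t) I ∧
      (I = 0 ↔ q.degree < n) := by
  obtain ⟨J, hJ, hint⟩ := h
  obtain ⟨c, hc, hc0⟩ := exists_reducesTo_mul_jacobi n ha hb hab q hq
  refine ⟨c * J, ?_, ?_⟩
  · simpa only [eval_mul] using hint _ c hN hc
  · rw [mul_eq_zero, or_iff_left hJ, hc0]

lemma IntegralReduces.orthogonalBelow {γ : ℝ → ℂ} {w : ℂ → ℂ} {a b : ℝ} {n : ℕ}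
    (h : IntegralReduces γ w a b (2 * n)) (ha : ∀ m : ℤ, (a : ℂ) ≠ m) (hb : ∀ m : ℤ, (b : ℂ) ≠ m)
    (hab : ∀ m : ℤ, (a : ℂ) + b ≠ m) : OrthogonalBelow γ w n (jacobi n a b) := by
  intro q hq
  obtain ⟨I, hI, hI0⟩ := h.exists_integral ha hb hab q hq.le (by
    rw [degree_mul, degree_jacobi n hab, two_mul, Nat.cast_add]
    exact WithBot.add_lt_add_right (WithBot.natCast_ne_bot n) hq)
  rwa [hI0.2 hq] at hI

lemma IntegralReduces.nonorthogonalAt {γ : ℝ → ℂ} {w : ℂ → ℂ} {a b : ℝ} {n : ℕ}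
    (h : IntegralReduces γ w a b (2 * n + 1)) (ha : ∀ m : ℤ, (a : ℂ) ≠ m)
    (hb : ∀ m : ℤ, (b : ℂ) ≠ m) (hab : ∀ m : ℤ, (a : ℂ) + b ≠ m) :
    NonorthogonalAt γ w n (jacobi n a b) := by
  intro q hq
  obtain ⟨I, hI, hI0⟩ := h.exists_integral ha hb hab q hq.le (by
    rw [degree_mul, degree_jacobi n hab, hq]
    exact_mod_cast (by omega : n + n < 2 * n + 1))
  exact ⟨I, fun h0 => (hI0.1 h0).ne hq, hI⟩

/-- Subtract the multiple of `P_n` with the same coefficient of degree `n`. A nonzero remainder `r`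
has some degree `m < n`; against `P_m` the `P_n` part reduces to `0` and `r` to a nonzero constant.
All products have degree below `2 n`, so this also covers the divergent case. -/
lemma IntegralReduces.characterizedUpToConstant {γ : ℝ → ℂ} {w : ℂ → ℂ} {a b : ℝ} {n : ℕ}
    (h : IntegralReduces γ w a b (2 * n)) (ha : ∀ m : ℤ, (a : ℂ) ≠ m) (hb : ∀ m : ℤ, (b : ℂ) ≠ m)
    (hab : ∀ m : ℤ, (a : ℂ) + b ≠ m) : CharacterizedUpToConstant γ w n (jacobi n a b) := by
  have horth := h.orthogonalBelow ha hb hab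
  have hscale : ∀ c : ℂ, OrthogonalBelow γ w n (C c * jacobi n a b) := fun c q hq => by
    have hcq : (C c * q).degree < n := by
      rcases eq_or_ne c 0 with rfl | hc
      · simp
      · rwa [degree_C_mul hc]
    convert horth (C c * q) hcq using 2 with t
    simp only [eval_mul, eval_C]; ring
  intro p hp
  refine ⟨fun hp_orth => ?_, ?_⟩
  · have hPn := degree_jacobi n hab
    have hlead : (jacobi n (a : ℂ) b).coeff n ≠ 0 := coeff_ne_zero_of_eq_degree hPn
    set c : ℂ := p.coeff n / (jacobi n (a : ℂ) b).coeff n with hc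
    refine ⟨c, ?_⟩
    by_contra hne
    set r : ℂ[X] := p - C c * jacobi n a b with hr
    have hr0 : r ≠ 0 := sub_ne_zero.2 hne
    have hrdeg : r.degree < n := by
      rw [degree_lt_iff_coeff_zero]
      intro m hm
      rw [hr, coeff_sub, coeff_C_mul]
      rcases hm.eq_or_lt with rfl | hm
      · rw [hc, div_mul_cancel₀ _ hlead, sub_self]
      · rw [coeff_eq_zero_of_degree_lt (hp.trans_lt (by exact_mod_cast hm)),
          coeff_eq_zero_of_degree_lt (hPn.trans_lt (by exact_mod_cast hm)), mul_zero, sub_zero]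
    set m := r.natDegree with hm
    have hrm : r.degree = m := degree_eq_natDegree hr0
    have hmn : m < n := by rw [hrm] at hrdeg; exact_mod_cast hrdeg
    have hPm := degree_jacobi m hab
    have hPmlt : (jacobi m (a : ℂ) b).degree < n := by rw [hPm]; exact_mod_cast hmn
    obtain ⟨d, hd, hd0⟩ := exists_reducesTo_mul_jacobi m ha hb hab r hrm.le
    obtain ⟨e, he, he0⟩ := exists_reducesTo_mul_jacobi n ha hb hab _ hPmlt.le
    rw [he0.2 hPmlt] at he
    obtain ⟨J, hJ, hint⟩ := h
    have hred := hd.sub (he.const_mul (-c))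
    rw [mul_zero, sub_zero, show r * jacobi m a b - C (-c) * (jacobi m a b * jacobi n a b) =
      jacobi m a b * p by rw [hr, C_neg]; ring] at hred
    have hint' := hint _ d (by
      rw [degree_mul, hPm]
      calc (m : WithBot ℕ) + p.degree ≤ m + n := by gcongr
        _ < ((2 * n : ℕ) : WithBot ℕ) := by exact_mod_cast (by omega : m + n < 2 * n)) hred
    simp only [eval_mul] at hint'
    exact mul_ne_zero (fun h0 => (hd0.1 h0).ne hrm) hJ (hint'.unique (hp_orth _ hPmlt))
  · rintro ⟨c, rfl⟩
    exact hscale c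

/-! ### Boundary behaviour -/

lemma tendsto_norm_rpow_zero {a : ℝ} (ha : 0 < a) {l : Filter ℂ} {f : ℂ → ℂ}
    (hf : Tendsto f l (𝓝 0)) : Tendsto (fun z => ‖f z‖ ^ a) l (𝓝 0) := by
  have h := hf.norm
  rw [norm_zero] at h
  simpa [Real.zero_rpow ha.ne'] using h.rpow_const (p := a) (Or.inr ha.le)

namespace IsLogPair

variable {Ω : Set ℂ} {σ τ : ℂ} {u v : ℂ → ℂ} {l : Filter ℂ}

lemma tendsto_weight_mul_nhds_one (h : IsLogPair Ω σ τ u v) {a : ℝ} (b : ℝ) (ha : -1 < a)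
    (hl : l ≤ 𝓝 1) (hΩ : Ω ∈ l) (R : ℂ[X]) :
    Tendsto (fun z => weight u v a b z * ((1 - z ^ 2) * R.eval z)) l (𝓝 0) := by
  rw [tendsto_zero_iff_norm_tendsto_zero]
  have e : (fun z => ‖1 - z‖ ^ (a + 1) * ‖1 + z‖ ^ (b + 1) * ‖R.eval z‖) =ᶠ[l]
      fun z => ‖weight u v a b z * ((1 - z ^ 2) * R.eval z)‖ := by
    filter_upwards [hΩ] with z hz using (h.norm_weight_mul a b R hz).symm
  refine Tendsto.congr' e ?_
  have h1 : Tendsto (fun z : ℂ => ‖1 - z‖ ^ (a + 1)) l (𝓝 0) := by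
    refine tendsto_norm_rpow_zero (by linarith) (Tendsto.mono_left ?_ hl)
    exact (Continuous.tendsto' (by fun_prop) _ _ (by norm_num))
  have h2 : Tendsto (fun z : ℂ => ‖1 + z‖ ^ (b + 1)) l (𝓝 (‖(1 : ℂ) + 1‖ ^ (b + 1))) := by
    refine Tendsto.rpow_const (Tendsto.mono_left ?_ hl) (Or.inl (by norm_num))
    exact (Continuous.tendsto' (by fun_prop) _ _ rfl)
  have h3 : Tendsto (fun z : ℂ => ‖R.eval z‖) l (𝓝 ‖R.eval 1‖) :=
    (R.continuous.norm.tendsto 1).mono_left hl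
  simpa using (h1.mul h2).mul h3

lemma tendsto_weight_mul_nhds_neg_one (h : IsLogPair Ω σ τ u v) (a : ℝ) {b : ℝ} (hb : -1 < b)
    (hl : l ≤ 𝓝 (-1)) (hΩ : Ω ∈ l) (R : ℂ[X]) :
    Tendsto (fun z => weight u v a b z * ((1 - z ^ 2) * R.eval z)) l (𝓝 0) := by
  rw [tendsto_zero_iff_norm_tendsto_zero]
  have e : (fun z => ‖1 - z‖ ^ (a + 1) * ‖1 + z‖ ^ (b + 1) * ‖R.eval z‖) =ᶠ[l]
      fun z => ‖weight u v a b z * ((1 - z ^ 2) * R.eval z)‖ := by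
    filter_upwards [hΩ] with z hz using (h.norm_weight_mul a b R hz).symm
  refine Tendsto.congr' e ?_
  have h1 : Tendsto (fun z : ℂ => ‖1 + z‖ ^ (b + 1)) l (𝓝 0) := by
    refine tendsto_norm_rpow_zero (by linarith) (Tendsto.mono_left ?_ hl)
    exact (Continuous.tendsto' (by fun_prop) _ _ (by norm_num))
  have h2 : Tendsto (fun z : ℂ => ‖1 - z‖ ^ (a + 1)) l (𝓝 (‖(1 : ℂ) - -1‖ ^ (a + 1))) := by
    refine Tendsto.rpow_const (Tendsto.mono_left ?_ hl) (Or.inl (by norm_num))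
    exact (Continuous.tendsto' (by fun_prop) _ _ rfl)
  have h3 : Tendsto (fun z : ℂ => ‖R.eval z‖) l (𝓝 ‖R.eval (-1)‖) :=
    (R.continuous.norm.tendsto (-1)).mono_left hl
  simpa using (h2.mul h1).mul h3

end IsLogPair

/-- The quotient is the reversed polynomial at `z⁻¹`, which tends to `0`. -/
lemma tendsto_eval_div_pow_cobounded (R : ℂ[X]) :
    Tendsto (fun z => R.eval z / z ^ R.natDegree) (Bornology.cobounded ℂ) (𝓝 R.leadingCoeff) := by
  have h1 : Tendsto (fun z : ℂ => R.reverse.eval z⁻¹) (Bornology.cobounded ℂ)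
      (𝓝 R.leadingCoeff) := by
    rw [← coeff_zero_reverse, coeff_zero_eq_eval_zero]
    exact (R.reverse.continuous.tendsto 0).comp tendsto_inv₀_cobounded
  refine h1.congr' ?_
  filter_upwards [Bornology.eventually_ne_cobounded (0 : ℂ)] with z hz
  let := invertibleOfNonzero hz
  have h2 := eval₂_reverse_mul_pow (RingHom.id ℂ) z R
  rw [invOf_eq_inv] at h2
  rw [eq_div_iff (pow_ne_zero _ hz)]
  exact h2

/-- The growth of `(1 - z)^(a + 1) (1 + z)^(b + 1) R(z)` at infinity. -/
lemma IsLogPair.tendsto_norm_weight_mul_div {Ω : Set ℂ} {σ τ : ℂ} {u v : ℂ → ℂ} {l : Filter ℂ}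
    (h : IsLogPair Ω σ τ u v) (a b : ℝ) (hl : l ≤ Bornology.cobounded ℂ) (hΩ : Ω ∈ l)
    (R : ℂ[X]) :
    Tendsto (fun z => ‖weight u v a b z * ((1 - z ^ 2) * R.eval z)‖ /
      ‖z‖ ^ (a + b + 2 + R.natDegree)) l (𝓝 ‖R.leadingCoeff‖) := by
  have hinv : Tendsto (fun z : ℂ => z⁻¹) l (𝓝 0) := tendsto_inv₀_cobounded.mono_left hl
  have h1 : Tendsto (fun z : ℂ => ‖z⁻¹ - 1‖ ^ (a + 1)) l (𝓝 1) := by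
    have := (hinv.sub_const 1).norm.rpow_const (p := a + 1) (Or.inl (by norm_num))
    simpa using this
  have h2 : Tendsto (fun z : ℂ => ‖z⁻¹ + 1‖ ^ (b + 1)) l (𝓝 1) := by
    have := (hinv.add_const 1).norm.rpow_const (p := b + 1) (Or.inl (by norm_num))
    simpa using this
  have h3 := ((tendsto_eval_div_pow_cobounded R).mono_left hl).norm
  have key := (h1.mul h2).mul h3
  rw [one_mul, one_mul] at key
  refine key.congr' ?_
  filter_upwards [hΩ, (Bornology.eventually_ne_cobounded (0 : ℂ)).filter_mono hl] with z hz hz0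
  have hpos : 0 < ‖z‖ := norm_pos_iff.2 hz0
  rw [h.norm_weight_mul a b R hz, show z⁻¹ - 1 = (1 - z) / z by rw [sub_div, div_self hz0, one_div],
    show z⁻¹ + 1 = (1 + z) / z by rw [add_div, div_self hz0, one_div], norm_div, norm_div, norm_div, norm_pow,
    Real.div_rpow (norm_nonneg _) (norm_nonneg _), Real.div_rpow (norm_nonneg _) (norm_nonneg _),
    show a + b + 2 + (R.natDegree : ℝ) = (a + 1) + (b + 1) + R.natDegree by ring,
    Real.rpow_add hpos (a + 1 + (b + 1)), Real.rpow_add hpos (a + 1), Real.rpow_natCast]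
  have p1 := (Real.rpow_pos_of_pos hpos (a + 1)).ne'
  have p2 := (Real.rpow_pos_of_pos hpos (b + 1)).ne'
  field_simp

lemma IsLogPair.tendsto_weight_mul_cobounded {Ω : Set ℂ} {σ τ : ℂ} {u v : ℂ → ℂ} {l : Filter ℂ}
    (h : IsLogPair Ω σ τ u v) {a b : ℝ} (hl : l ≤ Bornology.cobounded ℂ) (hΩ : Ω ∈ l)
    (R : ℂ[X]) (hR : a + b + 2 + R.natDegree < 0) :
    Tendsto (fun z => weight u v a b z * ((1 - z ^ 2) * R.eval z)) l (𝓝 0) := by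
  rw [tendsto_zero_iff_norm_tendsto_zero]
  have h1 : Tendsto (fun z : ℂ => ‖z‖ ^ (a + b + 2 + R.natDegree)) l (𝓝 0) := by
    have := (tendsto_rpow_neg_atTop (neg_pos.2 hR)).comp (tendsto_norm_cobounded_atTop.mono_left hl)
    simpa [Function.comp_def] using this
  have h2 := (h.tendsto_norm_weight_mul_div a b hl hΩ R).mul h1
  rw [mul_zero] at h2
  refine h2.congr' ?_
  filter_upwards [(Bornology.eventually_ne_cobounded (0 : ℂ)).filter_mono hl] with z hz0
  exact div_mul_cancel₀ _ (Real.rpow_pos_of_pos (norm_pos_iff.2 hz0) _).ne'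

lemma IsLogPair.tendsto_norm_weight_mul_atTop {Ω : Set ℂ} {σ τ : ℂ} {u v : ℂ → ℂ} {l : Filter ℂ}
    (h : IsLogPair Ω σ τ u v) {a b : ℝ} (hl : l ≤ Bornology.cobounded ℂ) (hΩ : Ω ∈ l)
    {R : ℂ[X]} (hR0 : R ≠ 0) (hR : 0 < a + b + 2 + R.natDegree) :
    Tendsto (fun z => ‖weight u v a b z * ((1 - z ^ 2) * R.eval z)‖) l atTop := by
  have h1 : Tendsto (fun z : ℂ => ‖z‖ ^ (a + b + 2 + R.natDegree)) l atTop :=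
    (tendsto_rpow_atTop hR).comp (tendsto_norm_cobounded_atTop.mono_left hl)
  have h2 := (h.tendsto_norm_weight_mul_div a b hl hΩ R).pos_mul_atTop
    (norm_pos_iff.2 (leadingCoeff_ne_zero.2 hR0)) h1
  refine h2.congr' ?_
  filter_upwards [(Bornology.eventually_ne_cobounded (0 : ℂ)).filter_mono hl] with z hz0
  exact div_mul_cancel₀ _ (Real.rpow_pos_of_pos (norm_pos_iff.2 hz0) _).ne'

/-! ### The plane cut along `[-1, ∞)` -/

lemma mem_compl_ofReal_Ici {z : ℂ} {r : ℝ} :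
    z ∈ (Complex.ofReal '' Ici r)ᶜ ↔ z.re < r ∨ z.im ≠ 0 := by
  constructor
  · intro h
    by_contra hc
    push Not at hc
    exact h ⟨z.re, hc.1, Complex.ext rfl hc.2.symm⟩
  · rintro h ⟨x, hx, rfl⟩
    rcases h with h | h
    · exact absurd (mem_Ici.1 hx) (not_le.2 h)
    · exact h (Complex.ofReal_im x)

lemma isOpen_compl_ofReal_Ici (r : ℝ) : IsOpen (Complex.ofReal '' Ici r)ᶜ :=
  (Complex.isometry_ofReal.isClosedEmbedding.isClosedMap _ isClosed_Ici).isOpen_compl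

lemma one_sub_mem_slitPlane {z : ℂ} (hz : z ∈ (Complex.ofReal '' Ici (-1))ᶜ) :
    1 - z ∈ Complex.slitPlane := by
  rcases mem_compl_ofReal_Ici.1 hz with h | h
  · left; simp only [Complex.sub_re, Complex.one_re]; linarith
  · right; simpa using h

lemma neg_one_add_mem_slitPlane {z : ℂ} (hz : z ∈ (Complex.ofReal '' Ici (-1))ᶜ) :
    -(1 + z) ∈ Complex.slitPlane := by
  rcases mem_compl_ofReal_Ici.1 hz with h | h
  · left; simp only [Complex.neg_re, Complex.add_re, Complex.one_re]; linarith
  · right; simpa using h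

/-- The principal logarithm of `1 + z` has its cut on the wrong side; that of `-(1 + z)` is cut
along `[-1, ∞)`, at the price of a constant factor in the weight. -/
lemma isLogPair_compl_Ici : IsLogPair (Complex.ofReal '' Ici (-1))ᶜ 1 (-1)
    (fun z => Complex.log (1 - z)) (fun z => Complex.log (-(1 + z))) where
  isOpen := isOpen_compl_ofReal_Ici _
  sq_left := by norm_num
  sq_right := by norm_num
  exp_left z hz := by
    rw [Complex.exp_log (Complex.slitPlane_ne_zero (one_sub_mem_slitPlane hz)), one_mul]
  exp_right z hz := by
    rw [Complex.exp_log (Complex.slitPlane_ne_zero (neg_one_add_mem_slitPlane hz)), neg_one_mul]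
  hasDerivAt_left z hz := by
    refine (((hasDerivAt_id z).const_sub 1).clog (one_sub_mem_slitPlane hz)).congr_deriv ?_
    simp [div_eq_mul_inv]
  hasDerivAt_right z hz := by
    refine (((hasDerivAt_id z).const_add 1).neg.clog (neg_one_add_mem_slitPlane hz)).congr_deriv ?_
    simp [div_eq_mul_inv, ← inv_neg, -neg_add_rev]

/-! ### An incomplete beta integral -/

/-- The incomplete beta integral `∫₀¹ s^b (2 - s (z + 1))^a ds`. -/
def incompleteBeta (a b : ℝ) (z : ℂ) : ℂ :=
  ∫ s in (0 : ℝ)..1, ((s ^ b : ℝ) : ℂ) * (2 - s * (z + 1)) ^ (a : ℂ)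

lemma two_sub_mem_slitPlane {z : ℂ} (hz : z ∈ (Complex.ofReal '' Ici 1)ᶜ) {s : ℝ}
    (hs : s ∈ Icc (0 : ℝ) 1) : 2 - s * (z + 1) ∈ Complex.slitPlane := by
  rcases hs.1.eq_or_lt with rfl | hs0
  · left; simp
  rcases mem_compl_ofReal_Ici.1 hz with h | h
  · left
    simp only [Complex.sub_re, Complex.mul_re, Complex.ofReal_re, Complex.add_re, Complex.one_re,
      Complex.ofReal_im, zero_mul, sub_zero, Complex.re_ofNat]
    nlinarith [hs.2]
  · right
    simp only [Complex.sub_im, Complex.mul_im, Complex.ofReal_re, Complex.add_im, Complex.one_im,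
      Complex.ofReal_im, zero_mul, add_zero, Complex.im_ofNat, zero_sub]
    exact neg_ne_zero.2 (mul_ne_zero hs0.ne' h)

lemma norm_two_sub_le {z : ℂ} {s : ℝ} (hs : s ∈ Icc (0 : ℝ) 1) :
    ‖2 - s * (z + 1)‖ ≤ 2 + ‖z + 1‖ := by
  refine (norm_sub_le _ _).trans ?_
  rw [norm_mul, Complex.norm_real, Real.norm_of_nonneg hs.1]
  have : s * ‖z + 1‖ ≤ 1 * ‖z + 1‖ := by gcongr; exact hs.2
  simpa using this

lemma measurable_betaIntegrand (a b : ℝ) (z : ℂ) :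
    Measurable fun s : ℝ => ((s ^ b : ℝ) : ℂ) * (2 - s * (z + 1)) ^ (a : ℂ) := by
  fun_prop

/-- Differentiation under the integral sign; `a > 1` and `b > 0` make the differentiated integrand
bounded uniformly near `z`. -/
lemma hasDerivAt_incompleteBeta {a b : ℝ} (ha : 1 < a) (hb : 0 < b) {z : ℂ}
    (hz : z ∈ (Complex.ofReal '' Ici 1)ᶜ) :
    IntervalIntegrable (fun s : ℝ => ((s ^ b : ℝ) : ℂ) *
      (a * (2 - s * (z + 1)) ^ ((a : ℂ) - 1) * -s)) MeasureTheory.volume 0 1 ∧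
    HasDerivAt (incompleteBeta a b) (∫ s in (0 : ℝ)..1, ((s ^ b : ℝ) : ℂ) *
      (a * (2 - s * (z + 1)) ^ ((a : ℂ) - 1) * -s)) z := by
  have hU : (Complex.ofReal '' Ici 1)ᶜ ∩ Metric.ball z 1 ∈ 𝓝 z :=
    inter_mem ((isOpen_compl_ofReal_Ici 1).mem_nhds hz) (Metric.ball_mem_nhds z one_pos)
  have hI : uIoc (0 : ℝ) 1 ⊆ Icc 0 1 := by
    rw [uIoc_of_le zero_le_one]; exact Ioc_subset_Icc_self
  have hpow : ∀ s ∈ Icc (0 : ℝ) 1, ‖((s ^ b : ℝ) : ℂ)‖ ≤ 1 := fun s hs => by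
    rw [Complex.norm_real, Real.norm_of_nonneg (Real.rpow_nonneg hs.1 b)]
    exact Real.rpow_le_one hs.1 hs.2 hb.le
  refine intervalIntegral.hasDerivAt_integral_of_dominated_loc_of_deriv_le (a := 0) (b := 1)
    (F := fun z s => ((s ^ b : ℝ) : ℂ) * (2 - s * (z + 1)) ^ (a : ℂ))
    (F' := fun z s => ((s ^ b : ℝ) : ℂ) * (a * (2 - s * (z + 1)) ^ ((a : ℂ) - 1) * -s))
    (bound := fun _ => a * (2 + (‖z + 1‖ + 1)) ^ (a - 1)) hU
    (Eventually.of_forall fun x => (measurable_betaIntegrand a b x).aestronglyMeasurable)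
    ?_ ?_ ?_ intervalIntegrable_const ?_
  · refine ContinuousOn.intervalIntegrable fun s hs => ?_
    rw [uIcc_of_le zero_le_one] at hs
    refine ContinuousAt.continuousWithinAt ?_
    have h1 : ContinuousAt (fun s : ℝ => ((s ^ b : ℝ) : ℂ)) s :=
      Complex.continuous_ofReal.continuousAt.comp
        (Real.continuousAt_rpow_const s b (Or.inr hb.le))
    exact h1.mul (ContinuousAt.cpow (by fun_prop) continuousAt_const
      (two_sub_mem_slitPlane hz hs))
  · exact Measurable.aestronglyMeasurable (by fun_prop)
  · refine Eventually.of_forall fun s hs x hx => ?_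
    have hs' := hI hs
    rw [norm_mul, norm_mul, norm_mul, norm_neg, Complex.norm_real, Complex.norm_real a,
      ← Complex.ofReal_one, ← Complex.ofReal_sub, Complex.norm_cpow_real,
      Real.norm_of_nonneg (zero_lt_one.trans ha).le]
    have h1 := hpow s hs'
    have h2 : ‖(s : ℂ)‖ ≤ 1 := by
      rw [Complex.norm_real, Real.norm_of_nonneg hs'.1]; exact hs'.2
    have h3 : ‖2 - s * (x + 1)‖ ^ (a - 1) ≤ (2 + (‖z + 1‖ + 1)) ^ (a - 1) := by
      refine Real.rpow_le_rpow (norm_nonneg _) ((norm_two_sub_le hs').trans ?_) (by linarith)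
      have h4 : ‖x - z‖ < 1 := by simpa [dist_eq_norm] using hx.2
      have h5 : ‖x + 1‖ ≤ ‖z + 1‖ + ‖x - z‖ := by
        refine le_trans (le_of_eq ?_) (norm_add_le _ _)
        congr 1; ring
      linarith
    have h6 : 0 ≤ a * (2 + (‖z + 1‖ + 1)) ^ (a - 1) := by positivity
    rw [Complex.norm_real] at h1
    rw [Complex.ofReal_one]
    calc ‖s ^ b‖ * (a * ‖2 - s * (x + 1)‖ ^ (a - 1) * ‖(s : ℂ)‖)
        ≤ 1 * (a * (2 + (‖z + 1‖ + 1)) ^ (a - 1) * 1) := by gcongr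
      _ = _ := by ring
  · refine Eventually.of_forall fun s hs x hx => ?_
    have h1 : HasDerivAt (fun x : ℂ => 2 - s * (x + 1)) (-(s : ℂ)) x := by
      simpa using (((hasDerivAt_id x).add_const 1).const_mul (s : ℂ)).const_sub 2
    exact (h1.cpow_const (two_sub_mem_slitPlane hx.1 (hI hs))).const_mul _

lemma intervalIntegrable_betaIntegrand {a b : ℝ} (ha : 0 < a) (hb : 0 < b) (z : ℂ) :
    IntervalIntegrable (fun s : ℝ => ((s ^ b : ℝ) : ℂ) * (2 - s * (z + 1)) ^ (a : ℂ))
      MeasureTheory.volume 0 1 := by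
  refine (intervalIntegrable_const (c := (2 + ‖z + 1‖) ^ a)).mono_fun
    (measurable_betaIntegrand a b z).aestronglyMeasurable ?_
  refine (MeasureTheory.ae_restrict_iff' measurableSet_uIoc).2 (Eventually.of_forall fun s hs => ?_)
  rw [uIoc_of_le zero_le_one] at hs
  have hs' := Ioc_subset_Icc_self hs
  beta_reduce
  rw [norm_mul, Complex.norm_real, Complex.norm_cpow_real,
    Real.norm_of_nonneg (Real.rpow_nonneg hs'.1 b), Real.norm_of_nonneg (by positivity)]
  calc s ^ b * ‖2 - s * (z + 1)‖ ^ a ≤ 1 * (2 + ‖z + 1‖) ^ a := by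
        gcongr
        · exact Real.rpow_le_one hs'.1 hs'.2 hb.le
        · exact norm_two_sub_le hs'
    _ = _ := one_mul _

/-- The differential equation satisfied by the incomplete beta integral. -/
lemma exists_hasDerivAt_incompleteBeta {a b : ℝ} (ha : 1 < a) (hb : 0 < b) {z : ℂ}
    (hz : z ∈ (Complex.ofReal '' Ici 1)ᶜ) :
    ∃ D, HasDerivAt (incompleteBeta a b) D z ∧
      ((b : ℂ) + 1) * incompleteBeta a b z + (z + 1) * D = (1 - z) ^ (a : ℂ) := by
  obtain ⟨hint, hderiv⟩ := hasDerivAt_incompleteBeta ha hb hz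
  refine ⟨_, hderiv, ?_⟩
  have hint0 := intervalIntegrable_betaIntegrand (zero_lt_one.trans ha) hb z
  rw [incompleteBeta, ← intervalIntegral.integral_const_mul, ← intervalIntegral.integral_const_mul,
    ← intervalIntegral.integral_add (hint0.const_mul _) (hint.const_mul _)]
  -- The left side is the integral of the `s`-derivative of `s^(b+1) (2 - s(z+1))^a`, which is `0`
  -- at `s = 0` and `(1 - z)^a` at `s = 1`.
  have hftc := intervalIntegral.integral_eq_sub_of_hasDerivAt (a := 0) (b := 1)
    (f := fun s : ℝ => ((s ^ (b + 1) : ℝ) : ℂ) * (2 - s * (z + 1)) ^ (a : ℂ))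
    (f' := fun s : ℝ => ((b : ℂ) + 1) * (((s ^ b : ℝ) : ℂ) * (2 - s * (z + 1)) ^ (a : ℂ)) +
      (z + 1) * (((s ^ b : ℝ) : ℂ) * (a * (2 - s * (z + 1)) ^ ((a : ℂ) - 1) * -s)))
    (fun s hs => ?_) ((hint0.const_mul _).add (hint.const_mul _))
  · rw [hftc]
    have hb1 : b + 1 ≠ 0 := by linarith
    simp only [Real.one_rpow, Real.zero_rpow hb1, Complex.ofReal_one, Complex.ofReal_zero]
    rw [show 2 - 1 * (z + 1) = 1 - z by ring]
    ring
  · rw [uIcc_of_le zero_le_one] at hs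
    have h1 : HasDerivAt (fun s : ℝ => ((s ^ (b + 1) : ℝ) : ℂ))
        (((b + 1) * s ^ b : ℝ) : ℂ) s := by
      have := (Real.hasDerivAt_rpow_const (x := s) (p := b + 1)
        (Or.inr (by linarith))).ofReal_comp
      simpa using this
    have h2 : HasDerivAt (fun x : ℂ => 2 - x * (z + 1)) (-(z + 1)) (s : ℂ) := by
      simpa using ((hasDerivAt_id (s : ℂ)).mul_const (z + 1)).const_sub 2
    have h3 := (h2.cpow_const (c := (a : ℂ)) (two_sub_mem_slitPlane hz hs)).comp_ofReal
    refine (h1.mul h3).congr_deriv ?_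
    have h4 : ((s ^ (b + 1) : ℝ) : ℂ) = ((s ^ b : ℝ) : ℂ) * s := by
      rw [Real.rpow_add_one' hs.1 (by linarith), Complex.ofReal_mul]
    rw [h4]
    push_cast
    ring

lemma tendsto_incompleteBeta_one {a b : ℝ} (ha : 0 < a) (hb : 0 < b) :
    Tendsto (incompleteBeta a b) (𝓝 1) (𝓝 (incompleteBeta a b 1)) := by
  refine intervalIntegral.tendsto_integral_filter_of_dominated_convergence
    (fun _ => (2 + 3 : ℝ) ^ a)
    (Eventually.of_forall fun z => (measurable_betaIntegrand a b z).aestronglyMeasurable)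
    ?_ intervalIntegrable_const ?_
  · filter_upwards [Metric.ball_mem_nhds (1 : ℂ) one_pos] with z hz
    refine Eventually.of_forall fun s hs => ?_
    rw [uIoc_of_le zero_le_one] at hs
    have hs' := Ioc_subset_Icc_self hs
    have hz3 : ‖z + 1‖ ≤ 3 := by
      have h1 : ‖z - 1‖ < 1 := by simpa [dist_eq_norm] using hz
      have h2 : ‖z + 1‖ ≤ ‖z - 1‖ + ‖(2 : ℂ)‖ := by
        refine le_trans (le_of_eq ?_) (norm_add_le _ _)
        congr 1; ring
      have h3 : ‖(2 : ℂ)‖ = 2 := by norm_num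
      linarith
    rw [norm_mul, Complex.norm_real, Complex.norm_cpow_real,
      Real.norm_of_nonneg (Real.rpow_nonneg hs'.1 b)]
    calc s ^ b * ‖2 - s * (z + 1)‖ ^ a ≤ 1 * (2 + 3) ^ a := by
          gcongr
          · exact Real.rpow_le_one hs'.1 hs'.2 hb.le
          · exact (norm_two_sub_le hs').trans (by linarith)
      _ = _ := one_mul _
  · have hne : ∀ᵐ s : ℝ, s ≠ 1 := by simp [MeasureTheory.ae_iff]
    filter_upwards [hne] with s hs1 hs
    rw [uIoc_of_le zero_le_one] at hs
    have hlt : s < 1 := lt_of_le_of_ne hs.2 hs1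
    refine Tendsto.const_mul _ ?_
    have hslit : 2 - (s : ℂ) * (1 + 1) ∈ Complex.slitPlane := by
      left
      simp only [Complex.sub_re, Complex.mul_re, Complex.ofReal_re, Complex.add_re, Complex.one_re,
        Complex.ofReal_im, zero_mul, sub_zero, Complex.re_ofNat]
      linarith
    exact (ContinuousAt.cpow (f := fun z : ℂ => 2 - (s : ℂ) * (z + 1)) (by fun_prop)
      continuousAt_const hslit).tendsto

lemma incompleteBeta_one_ne_zero {a b : ℝ} (ha : 0 < a) (hb : 0 < b) :
    incompleteBeta a b 1 ≠ 0 := by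
  have e : incompleteBeta a b 1 = ((∫ s in (0 : ℝ)..1, s ^ b * (2 - s * (1 + 1)) ^ a : ℝ) : ℂ) := by
    rw [incompleteBeta, ← intervalIntegral.integral_ofReal]
    refine intervalIntegral.integral_congr fun s hs => ?_
    rw [uIcc_of_le zero_le_one] at hs
    rw [Complex.ofReal_mul, Complex.ofReal_cpow (x := 2 - s * (1 + 1)) (by linarith [hs.2])]
    push_cast
    rfl
  rw [e, Complex.ofReal_ne_zero]
  refine (intervalIntegral.intervalIntegral_pos_of_pos_on ?_ (fun s hs => ?_) zero_lt_one).ne'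
  · refine Continuous.intervalIntegrable ?_ _ _
    exact (Real.continuous_rpow_const hb.le).mul
      ((Real.continuous_rpow_const ha.le).comp (by fun_prop))
  · exact mul_pos (Real.rpow_pos_of_pos hs.1 b)
      (Real.rpow_pos_of_pos (by linarith [hs.2]) a)

/-! ### Primitives of the weight with a jump at `1` -/

lemma compl_Ici_mem_nhdsWithin_neg :
    (Complex.ofReal '' Ici (-1))ᶜ ∈ 𝓝[{z : ℂ | z.im < 0}] 1 :=
  mem_of_superset self_mem_nhdsWithin fun z hz =>
    mem_compl_ofReal_Ici.2 (Or.inr (LT.lt.ne (show z.im < 0 from hz)))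

lemma compl_Ici_mem_nhdsWithin_pos :
    (Complex.ofReal '' Ici (-1))ᶜ ∈ 𝓝[{z : ℂ | 0 < z.im}] 1 :=
  mem_of_superset self_mem_nhdsWithin fun z hz =>
    mem_compl_ofReal_Ici.2 (Or.inr (LT.lt.ne' (show 0 < z.im from hz)))

/-- From below `1`, the point `-(1 + z)` approaches `-2` from above, where the argument tends to
`π`. -/
lemma tendsto_log_neg_one_add_nhdsWithin_neg :
    Tendsto (fun z : ℂ => Complex.log (-(1 + z))) (𝓝[{z | z.im < 0}] 1)
      (𝓝 (Real.log 2 + Real.pi * Complex.I)) := by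
  have h := Complex.tendsto_log_nhdsWithin_im_nonneg_of_re_neg_of_im_zero (z := -2)
    (by norm_num) (by norm_num)
  rw [norm_neg, Complex.norm_ofNat] at h
  refine h.comp (tendsto_nhdsWithin_iff.2 ⟨?_, ?_⟩)
  · exact (Continuous.tendsto' (by fun_prop) _ _ (by norm_num)).mono_left nhdsWithin_le_nhds
  · filter_upwards [self_mem_nhdsWithin] with z hz
    have hz' : z.im < 0 := hz
    simp [hz'.le]

lemma tendsto_log_neg_one_add_nhdsWithin_pos :
    Tendsto (fun z : ℂ => Complex.log (-(1 + z))) (𝓝[{z | 0 < z.im}] 1)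
      (𝓝 (Real.log 2 - Real.pi * Complex.I)) := by
  have h := Complex.tendsto_log_nhdsWithin_im_neg_of_re_neg_of_im_zero (z := -2)
    (by norm_num) (by norm_num)
  rw [norm_neg, Complex.norm_ofNat] at h
  refine h.comp (tendsto_nhdsWithin_iff.2 ⟨?_, ?_⟩)
  · exact (Continuous.tendsto' (by fun_prop) _ _ (by norm_num)).mono_left nhdsWithin_le_nhds
  · filter_upwards [self_mem_nhdsWithin] with z hz
    have hz' : 0 < z.im := hz
    simp [hz']

/-- The primitive of the weight given by the incomplete beta integral, for large exponents. -/
lemma hasPrimitiveWithJump_of_one_lt {a b : ℝ} (ha : 1 < a) (hb : 0 < b) (hbZ : ∀ m : ℤ, b ≠ m) :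
    HasPrimitiveWithJump (Complex.ofReal '' Ici (-1))ᶜ
      (weight (fun z => Complex.log (1 - z)) (fun z => Complex.log (-(1 + z))) a b)
      (𝓝[{z | z.im < 0}] 1) (𝓝[{z | 0 < z.im}] 1) := by
  have hpair := isLogPair_compl_Ici
  have hΦ := tendsto_incompleteBeta_one (zero_lt_one.trans ha) hb
  have hΦ0 := incompleteBeta_one_ne_zero (zero_lt_one.trans ha) hb
  -- Substituting `1 + t = s (1 + z)` in the integral of the weight from `-1` to `z` gives this
  -- product; the sign comes from the use of `-(1 + z)`. The beta factor is continuous at `1`, so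
  -- only the power jumps.
  refine ⟨fun z => -(Complex.exp (((b : ℂ) + 1) * Complex.log (-(1 + z))) * incompleteBeta a b z),
    -(Complex.exp (((b : ℂ) + 1) * (Real.log 2 + Real.pi * Complex.I)) * incompleteBeta a b 1),
    -(Complex.exp (((b : ℂ) + 1) * (Real.log 2 - Real.pi * Complex.I)) * incompleteBeta a b 1),
    fun z hz => ?_, ?_, ?_, ?_⟩
  · have hz1 : z ∈ (Complex.ofReal '' Ici 1)ᶜ := fun ⟨x, hx, hxz⟩ =>
      hz ⟨x, by rw [mem_Ici] at hx ⊢; linarith, hxz⟩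
    obtain ⟨D, hD, hode⟩ := exists_hasDerivAt_incompleteBeta ha hb hz1
    refine (((hpair.hasDerivAt_right z hz).const_mul ((b : ℂ) + 1)).cexp.mul hD).neg.congr_deriv ?_
    have h1 := hpair.one_add_ne_zero hz
    rw [Complex.cpow_def_of_ne_zero (hpair.one_sub_ne_zero hz)] at hode
    rw [weight, Complex.exp_add, mul_comm (a : ℂ), ← hode,
      show ((b : ℂ) + 1) * Complex.log (-(1 + z)) =
        b * Complex.log (-(1 + z)) + Complex.log (-(1 + z)) by ring, Complex.exp_add,
      Complex.exp_log (neg_ne_zero.2 h1)]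
    field_simp
    ring
  · exact (((tendsto_log_neg_one_add_nhdsWithin_neg.const_mul _).cexp).mul
      (hΦ.mono_left nhdsWithin_le_nhds)).neg
  · exact (((tendsto_log_neg_one_add_nhdsWithin_pos.const_mul _).cexp).mul
      (hΦ.mono_left nhdsWithin_le_nhds)).neg
  · intro h
    have h' := mul_right_cancel₀ hΦ0 (neg_injective h)
    obtain ⟨m, hm⟩ := Complex.exp_eq_exp_iff_exists_int.1 h'
    have hπ : (2 * Real.pi * Complex.I : ℂ) ≠ 0 := Complex.two_pi_I_ne_zero
    have h2 : (2 * Real.pi * Complex.I) * ((b : ℂ) + 1 - m) = 0 := by linear_combination hm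
    have h3 := (mul_eq_zero.1 h2).resolve_left hπ
    refine hbZ (m - 1) ?_
    have h4 : ((b : ℝ) : ℂ) = ((m - 1 : ℝ) : ℂ) := by push_cast; linear_combination h3
    rw [Complex.ofReal_injective h4]
    push_cast; rfl

/-! ### Lowering the exponents by one. -/

section Descent

variable {Ω : Set ℂ} {σ τ : ℂ} {u v : ℂ → ℂ} {l₀ l₁ : Filter ℂ} {a b : ℝ}

/-- From `L 1 = 2(b + 1) - (a + b + 2)(1 + X)`: the weight is a combination of `(w (1 - z²))'` and
the weight with `b + 1`. The boundary term vanishes at `1`, so the jump is only scaled, by a nonzero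
factor. -/
lemma IsLogPair.hasPrimitiveWithJump_of_add_one_right (h : IsLogPair Ω σ τ u v) (ha : -1 < a)
    (hl₀ : l₀ ≤ 𝓝 1) (hl₁ : l₁ ≤ 𝓝 1) (hΩ₀ : Ω ∈ l₀) (hΩ₁ : Ω ∈ l₁) (hb : (b : ℂ) + 1 ≠ 0)
    (hab : (a : ℂ) + b + 2 ≠ 0)
    (hjump : HasPrimitiveWithJump Ω (weight u v a (b + 1)) l₀ l₁) :
    HasPrimitiveWithJump Ω (weight u v a b) l₀ l₁ := by
  obtain ⟨F, A, B, hF, hA, hB, hne⟩ := hjump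
  have hτ := h.sq_right
  have hτ0 : τ ≠ 0 := by rintro rfl; norm_num at hτ
  have hX₀ := h.tendsto_weight_mul_nhds_one b ha hl₀ hΩ₀ 1
  have hX₁ := h.tendsto_weight_mul_nhds_one b ha hl₁ hΩ₁ 1
  set k : ℂ := (2 * ((b : ℂ) + 1))⁻¹ with hk
  have hk0 : k ≠ 0 := inv_ne_zero (mul_ne_zero two_ne_zero hb)
  refine ⟨fun z => k * (weight u v a b z * ((1 - z ^ 2) * eval z 1) + (a + b + 2) * τ * F z),
    k * (0 + (a + b + 2) * τ * A), k * (0 + (a + b + 2) * τ * B), fun z hz => ?_,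
    (hX₀.add (hA.const_mul _)).const_mul k, (hX₁.add (hB.const_mul _)).const_mul k, fun he => ?_⟩
  · refine (((h.hasDerivAt_weight_mul a b 1 hz).add ((hF z hz).const_mul _)).const_mul
      k).congr_deriv ?_
    rw [h.weight_add_one_right a b hz, weightedDeriv_apply]
    simp only [eval_add, eval_sub, eval_mul, eval_one, eval_X, eval_C, derivative_one,
      mul_zero, mul_one, zero_add]
    rw [hk]
    field_simp
    linear_combination weight u v a b z * ((a : ℂ) + b + 2) * (1 + z) * hτ
  · refine hne (mul_left_cancel₀ (mul_ne_zero hab hτ0) ?_)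
    simpa using mul_left_cancel₀ hk0 he

/-- Same argument with `L 1 = (a + b + 2)(1 - X) - 2(a + 1)`. -/
lemma IsLogPair.hasPrimitiveWithJump_of_add_one_left (h : IsLogPair Ω σ τ u v) (ha : -1 < a)
    (hl₀ : l₀ ≤ 𝓝 1) (hl₁ : l₁ ≤ 𝓝 1) (hΩ₀ : Ω ∈ l₀) (hΩ₁ : Ω ∈ l₁)
    (hab : (a : ℂ) + b + 2 ≠ 0)
    (hjump : HasPrimitiveWithJump Ω (weight u v (a + 1) b) l₀ l₁) :
    HasPrimitiveWithJump Ω (weight u v a b) l₀ l₁ := by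
  obtain ⟨F, A, B, hF, hA, hB, hne⟩ := hjump
  have ha1 : (a : ℂ) + 1 ≠ 0 := by
    have : a + 1 ≠ 0 := by linarith
    exact_mod_cast this
  have hσ := h.sq_left
  have hσ0 : σ ≠ 0 := by rintro rfl; norm_num at hσ
  have hX₀ := h.tendsto_weight_mul_nhds_one b ha hl₀ hΩ₀ 1
  have hX₁ := h.tendsto_weight_mul_nhds_one b ha hl₁ hΩ₁ 1
  set k : ℂ := (2 * ((a : ℂ) + 1))⁻¹ with hk
  have hk0 : k ≠ 0 := inv_ne_zero (mul_ne_zero two_ne_zero ha1)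
  refine ⟨fun z => k * ((a + b + 2) * σ * F z - weight u v a b z * ((1 - z ^ 2) * eval z 1)),
    k * ((a + b + 2) * σ * A - 0), k * ((a + b + 2) * σ * B - 0), fun z hz => ?_,
    ((hA.const_mul _).sub hX₀).const_mul k, ((hB.const_mul _).sub hX₁).const_mul k, fun he => ?_⟩
  · refine ((((hF z hz).const_mul _).sub (h.hasDerivAt_weight_mul a b 1 hz)).const_mul
      k).congr_deriv ?_
    rw [h.weight_add_one_left a b hz, weightedDeriv_apply]
    simp only [eval_add, eval_sub, eval_mul, eval_one, eval_X, eval_C, derivative_one,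
      mul_zero, mul_one, zero_add]
    rw [hk]
    field_simp
    linear_combination weight u v a b z * ((a : ℂ) + b + 2) * (1 - z) * hσ
  · refine hne (mul_left_cancel₀ (mul_ne_zero hab hσ0) ?_)
    simpa using mul_left_cancel₀ hk0 he

end Descent

/-- With `a > 1` fixed, `b` descends without bound, since the curve does not end at `-1`; then `a`
descends, staying above `-1`. Non-integrality keeps `b + 1` and `a + b + 2` nonzero. -/
lemma hasPrimitiveWithJump_one {a b : ℝ} (ha : -1 < a) (hbZ : ∀ m : ℤ, b ≠ m)
    (habZ : ∀ m : ℤ, a + b ≠ m) :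
    HasPrimitiveWithJump (Complex.ofReal '' Ici (-1))ᶜ
      (weight (fun z => Complex.log (1 - z)) (fun z => Complex.log (-(1 + z))) a b)
      (𝓝[{z | z.im < 0}] 1) (𝓝[{z | 0 < z.im}] 1) := by
  have hab2 : ∀ {a b : ℝ}, (∀ m : ℤ, a + b ≠ m) → (a : ℂ) + b + 2 ≠ 0 := fun {a b} h h0 => by
    refine h (-2) ?_
    have : a + b + 2 = 0 := by exact_mod_cast h0
    push_cast; linarith
  have hright : ∀ (N : ℕ) {a b : ℝ}, 1 < a → 0 < b + N → (∀ m : ℤ, b ≠ m) →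
      (∀ m : ℤ, a + b ≠ m) → HasPrimitiveWithJump (Complex.ofReal '' Ici (-1))ᶜ
      (weight (fun z => Complex.log (1 - z)) (fun z => Complex.log (-(1 + z))) a b)
      (𝓝[{z | z.im < 0}] 1) (𝓝[{z | 0 < z.im}] 1) := by
    intro N
    induction N with
    | zero => exact fun ha hb hbZ _ => hasPrimitiveWithJump_of_one_lt ha (by simpa using hb) hbZ
    | succ N ih =>
      intro a b ha hb hbZ habZ
      refine isLogPair_compl_Ici.hasPrimitiveWithJump_of_add_one_right (by linarith)
        nhdsWithin_le_nhds nhdsWithin_le_nhds compl_Ici_mem_nhdsWithin_neg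
        compl_Ici_mem_nhdsWithin_pos (fun h0 => hbZ (-1) ?_) (hab2 habZ)
        (ih ha (by push_cast at hb; linarith) (fun m h0 => hbZ (m - 1) ?_)
          (fun m h0 => habZ (m - 1) ?_))
      · have : b + 1 = 0 := by exact_mod_cast h0
        push_cast; linarith
      · push_cast; linarith
      · push_cast; linarith
  have hleft : ∀ (N : ℕ) {a b : ℝ}, 1 < a + N → -1 < a → (∀ m : ℤ, b ≠ m) →
      (∀ m : ℤ, a + b ≠ m) → HasPrimitiveWithJump (Complex.ofReal '' Ici (-1))ᶜ
      (weight (fun z => Complex.log (1 - z)) (fun z => Complex.log (-(1 + z))) a b)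
      (𝓝[{z | z.im < 0}] 1) (𝓝[{z | 0 < z.im}] 1) := by
    intro N
    induction N with
    | zero =>
      intro a b ha _ hbZ habZ
      obtain ⟨K, hK⟩ := exists_nat_gt (-b)
      exact hright K (by simpa using ha) (by linarith) hbZ habZ
    | succ N ih =>
      intro a b haN ha hbZ habZ
      refine isLogPair_compl_Ici.hasPrimitiveWithJump_of_add_one_left ha
        nhdsWithin_le_nhds nhdsWithin_le_nhds compl_Ici_mem_nhdsWithin_neg
        compl_Ici_mem_nhdsWithin_pos (hab2 habZ)
        (ih (by push_cast at haN; linarith) (by linarith) hbZ fun m h0 => habZ (m - 1) ?_)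
      push_cast; linarith
  obtain ⟨K, hK⟩ := exists_nat_gt (1 - a)
  exact hleft K (by linarith) ha hbZ habZ

/-! ### The reflection `z ↦ -z` -/

lemma IsLogPair.comp_neg {Ω : Set ℂ} {σ τ : ℂ} {u v : ℂ → ℂ} (h : IsLogPair Ω σ τ u v) :
    IsLogPair (Neg.neg ⁻¹' Ω) τ σ (fun z => v (-z)) (fun z => u (-z)) where
  isOpen := h.isOpen.preimage continuous_neg
  sq_left := h.sq_right
  sq_right := h.sq_left
  exp_left z hz := by rw [h.exp_right (-z) hz, ← sub_eq_add_neg]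
  exp_right z hz := by rw [h.exp_left (-z) hz, sub_neg_eq_add]
  hasDerivAt_left z hz := by
    refine ((h.hasDerivAt_right (-z) hz).comp z (hasDerivAt_neg z)).congr_deriv ?_
    rw [← sub_eq_add_neg]; ring
  hasDerivAt_right z hz := by
    refine ((h.hasDerivAt_left (-z) hz).comp z (hasDerivAt_neg z)).congr_deriv ?_
    rw [sub_neg_eq_add]; ring

lemma HasPrimitiveWithJump.comp_neg {Ω : Set ℂ} {u v : ℂ → ℂ} {l₀ l₁ k₀ k₁ : Filter ℂ} {a b : ℝ}
    (h : HasPrimitiveWithJump Ω (weight u v a b) l₀ l₁) (h₀ : Tendsto Neg.neg k₀ l₀)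
    (h₁ : Tendsto Neg.neg k₁ l₁) :
    HasPrimitiveWithJump (Neg.neg ⁻¹' Ω) (weight (fun z => v (-z)) (fun z => u (-z)) b a)
      k₀ k₁ := by
  obtain ⟨F, A, B, hF, hA, hB, hne⟩ := h
  refine ⟨fun z => -F (-z), -A, -B, fun z hz => ?_, (hA.comp h₀).neg, (hB.comp h₁).neg,
    fun h0 => hne (neg_injective h0)⟩
  refine (((hF (-z) hz).comp z (hasDerivAt_neg z)).neg).congr_deriv ?_
  rw [weight, weight, add_comm]
  ring

lemma compl_Iic_eq_preimage_neg :
    (Complex.ofReal '' Iic 1)ᶜ = Neg.neg ⁻¹' (Complex.ofReal '' Ici (-1))ᶜ := by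
  ext z
  simp only [mem_compl_iff, mem_preimage, not_iff_not]
  constructor
  · rintro ⟨x, hx, rfl⟩
    exact ⟨-x, mem_Ici.2 (neg_le_neg (mem_Iic.1 hx)), by simp⟩
  · rintro ⟨x, hx, hxz⟩
    refine ⟨-x, ?_, by rw [Complex.ofReal_neg, hxz, neg_neg]⟩
    rw [mem_Ici] at hx
    rw [mem_Iic]; linarith

/-! ### The Möbius transformation exchanging `∞` and `1` -/

/-- The Möbius transformation `t ↦ (t - 3) / (t + 1)`, with `∞ ↦ 1`, `1 ↦ -1`, `-1 ↦ ∞`. -/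
def moebius (t : ℂ) : ℂ := 1 - 4 / (t + 1)

lemma add_one_ne_zero_of_mem {t : ℂ} (ht : t ∈ (Complex.ofReal '' (Iic (-1) ∪ Ici 1))ᶜ) :
    t + 1 ≠ 0 := by
  intro h0
  refine ht ⟨-1, Or.inl (mem_Iic.2 le_rfl), ?_⟩
  push_cast
  linear_combination -h0

lemma moebius_mem {t : ℂ} (ht : t ∈ (Complex.ofReal '' (Iic (-1) ∪ Ici 1))ᶜ) :
    moebius t ∈ (Complex.ofReal '' Ici (-1))ᶜ := by
  have h1 := add_one_ne_zero_of_mem ht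
  rintro ⟨x, hx, hxt⟩
  rw [mem_Ici] at hx
  have h2 : (1 - x : ℂ) * (t + 1) = 4 := by
    rw [hxt, moebius]; field_simp; ring
  have hx1 : (1 - x : ℝ) ≠ 0 := by
    intro h0
    have : (1 - x : ℂ) = 0 := by exact_mod_cast h0
    rw [this, zero_mul] at h2
    norm_num at h2
  have hx1' : (1 - x : ℂ) ≠ 0 := by exact_mod_cast hx1
  refine ht ⟨4 / (1 - x) - 1, ?_, ?_⟩
  · rcases lt_or_gt_of_ne hx1 with h | h
    · left
      rw [mem_Iic]
      have := div_nonpos_of_nonneg_of_nonpos (by norm_num : (0 : ℝ) ≤ 4) h.le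
      linarith
    · right
      rw [mem_Ici]
      have : 2 ≤ 4 / (1 - x) := by rw [le_div_iff₀ h]; linarith
      linarith
  · push_cast
    field_simp
    linear_combination -h2

lemma hasDerivAt_moebius {t : ℂ} (ht : t + 1 ≠ 0) :
    HasDerivAt moebius (4 / (t + 1) ^ 2) t := by
  have h := ((((hasDerivAt_id t).add_const 1).fun_inv ht).const_mul 4).const_sub 1
  simp only [id, ← div_eq_mul_inv] at h
  refine h.congr_deriv ?_
  ring

lemma im_moebius (t : ℂ) : (moebius t).im = 4 * t.im / Complex.normSq (t + 1) := by
  simp [moebius, Complex.div_im]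

lemma tendsto_moebius_cobounded : Tendsto moebius (Bornology.cobounded ℂ) (𝓝 1) := by
  have h1 : Tendsto (fun t : ℂ => t + 1) (Bornology.cobounded ℂ) (Bornology.cobounded ℂ) :=
    tendsto_add_const_cobounded 1
  have h2 : moebius = fun t => 1 - 4 * (t + 1)⁻¹ := by
    ext t; rw [moebius, div_eq_mul_inv]
  rw [h2]
  simpa using ((tendsto_inv₀_cobounded.comp h1).const_mul (4 : ℂ)).const_sub 1

/-- With `m = moebius t` one has `1 + t = 4 / (1 - m)` and `1 - t = -2 (1 + m) / (1 - m)`. -/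
lemma isLogPair_compl_Iic_union_Ici : IsLogPair (Complex.ofReal '' (Iic (-1) ∪ Ici 1))ᶜ 1 1
    (fun t => Complex.log (-(1 + moebius t)) - Complex.log (1 - moebius t) + Complex.log 2)
    (fun t => Complex.log 4 - Complex.log (1 - moebius t)) where
  isOpen := (Complex.isometry_ofReal.isClosedEmbedding.isClosedMap _
    (isClosed_Iic.union isClosed_Ici)).isOpen_compl
  sq_left := one_pow 2
  sq_right := one_pow 2
  exp_left t ht := by
    have h1 := add_one_ne_zero_of_mem ht
    have hm := moebius_mem ht
    rw [Complex.exp_add, Complex.exp_sub, Complex.exp_log two_ne_zero,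
      isLogPair_compl_Ici.exp_left _ hm, isLogPair_compl_Ici.exp_right _ hm, moebius]
    field_simp
    ring
  exp_right t ht := by
    have h1 := add_one_ne_zero_of_mem ht
    rw [Complex.exp_sub, Complex.exp_log (by norm_num : (4 : ℂ) ≠ 0),
      isLogPair_compl_Ici.exp_left _ (moebius_mem ht), moebius]
    field_simp
    ring
  hasDerivAt_left t ht := by
    have h1 := add_one_ne_zero_of_mem ht
    have hm := moebius_mem ht
    have h2 : 1 - t ≠ 0 := by
      intro h0
      refine ht ⟨1, Or.inr (mem_Ici.2 le_rfl), ?_⟩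
      push_cast
      linear_combination h0
    refine ((((isLogPair_compl_Ici.hasDerivAt_right _ hm).comp t (hasDerivAt_moebius h1)).sub
      ((isLogPair_compl_Ici.hasDerivAt_left _ hm).comp t (hasDerivAt_moebius h1))).add_const
      _).congr_deriv ?_
    rw [show 1 - moebius t = 4 / (t + 1) by rw [moebius]; ring,
      show 1 + moebius t = -2 * (1 - t) / (t + 1) by rw [moebius]; field_simp; ring]
    field_simp
    ring
  hasDerivAt_right t ht := by
    have h1 := add_one_ne_zero_of_mem ht
    have hm := moebius_mem ht
    refine (((isLogPair_compl_Ici.hasDerivAt_left _ hm).comp t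
      (hasDerivAt_moebius h1)).const_sub _).congr_deriv ?_
    rw [show 1 - moebius t = 4 / (t + 1) by rw [moebius]; ring, add_comm 1 t]
    field_simp

lemma hasPrimitiveWithJump_infty {a b : ℝ} (haZ : ∀ m : ℤ, a ≠ m) (hbZ : ∀ m : ℤ, b ≠ m)
    (hab : a + b < -1) :
    HasPrimitiveWithJump (Complex.ofReal '' (Iic (-1) ∪ Ici 1))ᶜ
      (weight (fun t => Complex.log (-(1 + moebius t)) - Complex.log (1 - moebius t) +
        Complex.log 2) (fun t => Complex.log 4 - Complex.log (1 - moebius t)) a b)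
      (Bornology.cobounded ℂ ⊓ 𝓟 {z | 0 < z.im}) (Bornology.cobounded ℂ ⊓ 𝓟 {z | z.im < 0}) := by
  -- In the variable `m`, the form `(1 - t)^a (1 + t)^b dt` is a constant times `(1 - m)^(-a-b-2)
  -- (-(1 + m))^a dm`; the first exponent exceeds `-1` exactly when `a + b < -1`, and the exponents
  -- sum to `-b - 2`.
  obtain ⟨F, A, B, hF, hA, hB, hne⟩ := hasPrimitiveWithJump_one (a := -a - b - 2) (b := a)
    (by linarith) haZ (fun m h0 => hbZ (-m - 2) (by push_cast; linarith))
  have hup : Tendsto moebius (Bornology.cobounded ℂ ⊓ 𝓟 {z | 0 < z.im})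
      (𝓝[{z | 0 < z.im}] 1) := by
    refine tendsto_nhdsWithin_iff.2 ⟨tendsto_moebius_cobounded.mono_left inf_le_left, ?_⟩
    refine Eventually.filter_mono inf_le_right (eventually_principal.2 fun t ht => ?_)
    have ht' : 0 < t.im := ht
    rw [mem_ofPred_eq, im_moebius]
    refine div_pos (by linarith) (Complex.normSq_pos.2 fun h0 => ?_)
    simpa [ht'.ne'] using congrArg Complex.im h0
  have hdown : Tendsto moebius (Bornology.cobounded ℂ ⊓ 𝓟 {z | z.im < 0})
      (𝓝[{z | z.im < 0}] 1) := by
    refine tendsto_nhdsWithin_iff.2 ⟨tendsto_moebius_cobounded.mono_left inf_le_left, ?_⟩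
    refine Eventually.filter_mono inf_le_right (eventually_principal.2 fun t ht => ?_)
    have ht' : t.im < 0 := ht
    rw [mem_ofPred_eq, im_moebius]
    refine div_neg_of_neg_of_pos (by linarith) (Complex.normSq_pos.2 fun h0 => ?_)
    simpa [ht'.ne] using congrArg Complex.im h0
  set k : ℂ := 4 * Complex.exp (a * Complex.log 2 + b * Complex.log 4) with hk
  have hk0 : k ≠ 0 := mul_ne_zero (by norm_num : (4 : ℂ) ≠ 0) (Complex.exp_ne_zero _)
  refine ⟨fun t => k * F (moebius t), k * B, k * A, fun t ht => ?_, (hB.comp hup).const_mul k,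
    (hA.comp hdown).const_mul k, fun h0 => hne (mul_left_cancel₀ hk0 h0).symm⟩
  have h1 := add_one_ne_zero_of_mem ht
  have hm := moebius_mem ht
  refine (((hF _ hm).comp t (hasDerivAt_moebius h1)).const_mul k).congr_deriv ?_
  have hsq : 4 / (t + 1) ^ 2 = Complex.exp (2 * Complex.log (1 - moebius t)) / 4 := by
    rw [two_mul, Complex.exp_add, isLogPair_compl_Ici.exp_left _ hm, moebius]
    field_simp
    ring
  rw [hsq, hk, weight, weight, mul_assoc, mul_div_assoc', ← Complex.exp_add, mul_div_assoc',
    ← Complex.exp_add, mul_div_cancel₀ _ (by norm_num : (4 : ℂ) ≠ 0)]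
  congr 1
  push_cast
  ring

/-! ### The three families of curves -/

lemma IsGammaOne.integralReduces {γ : ℝ → ℂ} (hγ : IsGammaOne γ) {a b : ℝ} (ha : -1 < a)
    (hbZ : ∀ m : ℤ, b ≠ m) (habZ : ∀ m : ℤ, a + b ≠ m) {w : ℂ → ℂ}
    (hw : IsWeightBranch a b γ w) (N : ℕ) : IntegralReduces γ w a b N :=
  isLogPair_compl_Ici.integralReduces hγ.curve (fun m h0 => habZ m (by exact_mod_cast h0)) hw
    hγ.start hγ.finish (hasPrimitiveWithJump_one ha hbZ habZ)
    (fun R _ => isLogPair_compl_Ici.tendsto_weight_mul_nhds_one b ha nhdsWithin_le_nhds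
      compl_Ici_mem_nhdsWithin_neg R)
    (fun R _ => isLogPair_compl_Ici.tendsto_weight_mul_nhds_one b ha nhdsWithin_le_nhds
      compl_Ici_mem_nhdsWithin_pos R)

lemma IsGammaNegOne.integralReduces {γ : ℝ → ℂ} (hγ : IsGammaNegOne γ) {a b : ℝ} (hb : -1 < b)
    (haZ : ∀ m : ℤ, a ≠ m) (habZ : ∀ m : ℤ, a + b ≠ m) {w : ℂ → ℂ}
    (hw : IsWeightBranch a b γ w) (N : ℕ) : IntegralReduces γ w a b N := by
  have hpos : Tendsto Neg.neg (𝓝[{z : ℂ | 0 < z.im}] (-1)) (𝓝[{z | z.im < 0}] 1) := by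
    refine tendsto_nhdsWithin_iff.2 ⟨?_, ?_⟩
    · exact (continuous_neg.tendsto' _ _ (neg_neg 1)).mono_left nhdsWithin_le_nhds
    · filter_upwards [self_mem_nhdsWithin] with z hz
      have hz' : 0 < z.im := hz
      simpa using hz'
  have hneg : Tendsto Neg.neg (𝓝[{z : ℂ | z.im < 0}] (-1)) (𝓝[{z | 0 < z.im}] 1) := by
    refine tendsto_nhdsWithin_iff.2 ⟨?_, ?_⟩
    · exact (continuous_neg.tendsto' _ _ (neg_neg 1)).mono_left nhdsWithin_le_nhds
    · filter_upwards [self_mem_nhdsWithin] with z hz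
      have hz' : z.im < 0 := hz
      simpa using hz'
  have hcurve := hγ.curve
  rw [compl_Iic_eq_preimage_neg] at hcurve
  have hpair := isLogPair_compl_Ici.comp_neg
  exact hpair.integralReduces hcurve (fun m h0 => habZ m (by exact_mod_cast h0)) hw
    hγ.start hγ.finish
    ((hasPrimitiveWithJump_one hb haZ (fun m h0 => habZ m (by linarith))).comp_neg hpos hneg)
    (fun R _ => hpair.tendsto_weight_mul_nhds_neg_one a hb nhdsWithin_le_nhds
      (hpos compl_Ici_mem_nhdsWithin_neg) R)
    (fun R _ => hpair.tendsto_weight_mul_nhds_neg_one a hb nhdsWithin_le_nhds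
      (hneg compl_Ici_mem_nhdsWithin_pos) R)

lemma mem_compl_of_im_ne_zero {z : ℂ} (hz : z.im ≠ 0) (s : Set ℝ) :
    z ∈ (Complex.ofReal '' s)ᶜ := by
  rintro ⟨x, -, rfl⟩
  exact hz (Complex.ofReal_im x)

lemma compl_mem_cobounded_inf_pos (s : Set ℝ) :
    (Complex.ofReal '' s)ᶜ ∈ Bornology.cobounded ℂ ⊓ 𝓟 {z : ℂ | 0 < z.im} :=
  mem_inf_of_right (mem_principal.2 fun z hz =>
    mem_compl_of_im_ne_zero (LT.lt.ne' (show 0 < z.im from hz)) s)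

lemma compl_mem_cobounded_inf_neg (s : Set ℝ) :
    (Complex.ofReal '' s)ᶜ ∈ Bornology.cobounded ℂ ⊓ 𝓟 {z : ℂ | z.im < 0} :=
  mem_inf_of_right (mem_principal.2 fun z hz =>
    mem_compl_of_im_ne_zero (LT.lt.ne (show z.im < 0 from hz)) s)

/-- Needed for `n = 0` on `Γ_∞`, where `a + b < 0` does not make `∫ w` converge; here only `p = 0`,
`c = 0` occur. -/
lemma integralReduces_zero (γ : ℝ → ℂ) (w : ℂ → ℂ) {a b : ℝ} (habZ : ∀ m : ℤ, a + b ≠ m) :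
    IntegralReduces γ w a b 0 := by
  refine ⟨1, one_ne_zero, fun p c hp hred => ?_⟩
  obtain ⟨R, hR⟩ := hred
  have hp0 : p = 0 := by simpa [degree_lt_iff_coeff_zero, Polynomial.ext_iff] using hp
  have hR0 : R = 0 := by
    by_contra hR0
    have := degree_eq_of_eq_weightedDeriv_add_C
      (fun m h0 => habZ m (by exact_mod_cast h0)) hR hR0
    rw [hp0, degree_zero] at this
    exact absurd this.symm (WithBot.natCast_ne_bot _)
  rw [hR0, map_zero, zero_add, hp0] at hR
  have hc : c = 0 := C_eq_zero.1 hR.symm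
  simp [HasContourIntegral, hp0, hc]

lemma IsGammaInfty.integralReduces {γ : ℝ → ℂ} (hγ : IsGammaInfty γ) {a b : ℝ}
    (haZ : ∀ m : ℤ, a ≠ m) (hbZ : ∀ m : ℤ, b ≠ m) (habZ : ∀ m : ℤ, a + b ≠ m) {w : ℂ → ℂ}
    (hw : IsWeightBranch a b γ w) {N : ℕ} (hN : a + b + N < 0) : IntegralReduces γ w a b N := by
  rcases Nat.eq_zero_or_pos N with rfl | hN0
  · exact integralReduces_zero γ w habZ
  have hpair := isLogPair_compl_Iic_union_Ici
  have hN1 : (1 : ℝ) ≤ N := by exact_mod_cast hN0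
  have hdeg : ∀ R : ℂ[X], R.natDegree + 1 < N → a + b + 2 + R.natDegree < 0 := fun R hR => by
    have : (R.natDegree : ℝ) + 2 ≤ N := by exact_mod_cast hR
    linarith
  exact hpair.integralReduces hγ.curve (fun m h0 => habZ m (by exact_mod_cast h0)) hw
    hγ.start hγ.finish (hasPrimitiveWithJump_infty haZ hbZ (by linarith))
    (fun R hR => hpair.tendsto_weight_mul_cobounded inf_le_left
      (compl_mem_cobounded_inf_pos _) R (hdeg R hR))
    (fun R hR => hpair.tendsto_weight_mul_cobounded inf_le_left
      (compl_mem_cobounded_inf_neg _) R (hdeg R hR))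

/-! ### Divergence on `Γ_∞`. -/

lemma exists_reducesTo {a b : ℂ} (h : ∀ m : ℤ, a + b ≠ m) (p : ℂ[X]) : ∃ c, ReducesTo a b p c := by
  suffices H : ∀ (N : ℕ) (p : ℂ[X]), p.natDegree ≤ N → ∃ c, ReducesTo a b p c from H _ p le_rfl
  intro N
  induction N with
  | zero =>
    intro p hp
    refine ⟨p.coeff 0, 0, ?_⟩
    rw [map_zero, zero_add]
    exact eq_C_of_natDegree_le_zero hp
  | succ N ih =>
    intro p hp
    have hcoeff := coeff_weightedDeriv_natDegree_succ a b (X ^ N)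
    rw [natDegree_X_pow, (monic_X_pow N).leadingCoeff, mul_one] at hcoeff
    have hne : -((N : ℂ) + a + b + 2) ≠ 0 := neg_ne_zero.2 fun h0 =>
      h (-(N + 2)) (by push_cast; linear_combination h0)
    set k : ℂ := p.coeff (N + 1) / -((N : ℂ) + a + b + 2) with hk
    obtain ⟨c, R, hR⟩ := ih (p - C k * weightedDeriv a b (X ^ N)) (by
      rw [natDegree_le_iff_coeff_eq_zero]
      intro m hm
      rw [coeff_sub, coeff_C_mul]
      rcases (Nat.succ_le_of_lt hm).eq_or_lt with rfl | hm
      · rw [Nat.succ_eq_add_one, hcoeff, hk, div_mul_cancel₀ _ hne, sub_self]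
      · have hle := natDegree_weightedDeriv_le a b (X ^ N)
        rw [natDegree_X_pow] at hle
        rw [coeff_eq_zero_of_natDegree_lt (hp.trans_lt hm),
          coeff_eq_zero_of_natDegree_lt (hle.trans_lt hm), mul_zero, sub_zero])
    refine ⟨c, R + C k * X ^ N, ?_⟩
    rw [map_add, ← smul_eq_C_mul, map_smul, smul_eq_C_mul]
    linear_combination hR

/-- The primitive of `w` itself may have no limit at infinity, so one factor `1 + z` is moved from
the weight to `p`. The weight with `b - 1` has a convergent primitive, while the boundary term, with
`deg R = d`, grows like `|z|^(a + b + d + 1)`. -/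
lemma IsGammaInfty.not_hasContourIntegral {γ : ℝ → ℂ} (hγ : IsGammaInfty γ) {a b : ℝ}
    (haZ : ∀ m : ℤ, a ≠ m) (hbZ : ∀ m : ℤ, b ≠ m) (habZ : ∀ m : ℤ, a + b ≠ m) (hab : a + b < 0)
    {w : ℂ → ℂ} (hw : IsWeightBranch a b γ w) {p : ℂ[X]} {d : ℕ} (hp : p.degree = d)
    (hd : 0 < a + b + d + 1) (I : ℂ) : ¬ HasContourIntegral γ (fun t => p.eval t * w t) I := by
  have hpair := isLogPair_compl_Iic_union_Ici
  obtain ⟨k, hk, hwk⟩ := hpair.exists_eq_const_mul_weight hγ.curve hw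
  obtain ⟨F, A, B, hF, -, hB, -⟩ := hasPrimitiveWithJump_infty haZ
    (b := b - 1) (fun m h0 => hbZ (m + 1) (by push_cast; linarith)) (by linarith)
  have habZ' : ∀ m : ℤ, (a : ℂ) + (b - 1 : ℝ) ≠ m := fun m h0 => by
    have h1 : a + (b - 1) = m := by exact_mod_cast h0
    exact habZ (m + 1) (by push_cast; linarith)
  obtain ⟨c, R, hR⟩ := exists_reducesTo habZ' (p * (X + 1))
  have hdeg : (p * (X + 1)).degree = ((d + 1 : ℕ) : WithBot ℕ) := by
    rw [degree_mul, hp, ← C_1, degree_X_add_C]; rfl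
  have hR0 : R ≠ 0 := by
    rintro rfl
    rw [hR, map_zero, zero_add] at hdeg
    have := degree_C_le (a := c)
    rw [hdeg] at this
    have h2 : d + 1 ≤ 0 := by exact_mod_cast this
    omega
  have hRdeg : R.natDegree = d := by
    have := degree_eq_of_eq_weightedDeriv_add_C habZ' hR hR0
    rw [hdeg] at this
    have h2 : d + 1 = R.natDegree + 1 := by exact_mod_cast this
    omega
  refine hγ.curve.not_hasContourIntegral hpair.isOpen
    (fun z hz => ((hpair.hasDerivAt_weight_mul a (b - 1) R hz).add
      ((hF z hz).const_mul c)).const_mul k) (fun z hz => ?_) hγ.finish ?_ I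
  · have hz' := hγ.curve.mapsTo.image_subset hz
    have hshift := hpair.weight_add_one_right a (b - 1) hz'
    rw [sub_add_cancel] at hshift
    have hev := congrArg (eval z) hR
    simp only [eval_mul, eval_add, eval_X, eval_one, eval_C] at hev
    rw [hwk z hz, hshift]
    linear_combination
      (k * weight _ _ a (b - 1) z) * hev
  · have htop := hpair.tendsto_norm_weight_mul_atTop (a := a) (b := b - 1) inf_le_left
      (compl_mem_cobounded_inf_neg _) hR0 (by rw [hRdeg]; linarith)
    have hsum := htop.atTop_add (hB.const_mul c).norm.neg
    refine tendsto_atTop_mono (fun z => ?_) (hsum.const_mul_atTop (norm_pos_iff.2 hk))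
    rw [Pi.add_apply, norm_mul k]
    refine mul_le_mul_of_nonneg_left ?_ (norm_nonneg k)
    have := norm_sub_le_norm_add (weight (fun t => Complex.log (-(1 + moebius t)) -
      Complex.log (1 - moebius t) + Complex.log 2)
      (fun t => Complex.log 4 - Complex.log (1 - moebius t)) a (b - 1) z *
        ((1 - z ^ 2) * eval z R)) (c * F z)
    linarith

lemma IsGammaInfty.divergentAt {γ : ℝ → ℂ} (hγ : IsGammaInfty γ) {a b : ℝ}
    (haZ : ∀ m : ℤ, a ≠ m) (hbZ : ∀ m : ℤ, b ≠ m) (habZ : ∀ m : ℤ, a + b ≠ m) (hab : a + b < 0)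
    {w : ℂ → ℂ} (hw : IsWeightBranch a b γ w) {n : ℕ} (hn : -1 < 2 * (n : ℝ) + a + b) :
    DivergentAt γ w n (jacobi n a b) := by
  rintro q hq ⟨I, hI⟩
  have hdeg : (q * jacobi n a b).degree = (2 * n : ℕ) := by
    rw [degree_mul, hq, degree_jacobi n (fun m h0 => habZ m (by exact_mod_cast h0)), two_mul]
    rfl
  refine hγ.not_hasContourIntegral haZ hbZ habZ hab hw hdeg (by push_cast; linarith) I ?_
  simpa only [eval_mul] using hI

end JacobiOrth
end

theorem theorem5p1 (n : ℕ) (α β : ℝ)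
    (hα : α ∉ Set.range ((↑) : ℤ → ℝ)) (hβ : β ∉ Set.range ((↑) : ℤ → ℝ))
    (hαβ : α + β ∉ Set.range ((↑) : ℤ → ℝ)) :
    (JacobiOrth.jacobi n α β).degree = n ∧
    (-1 < α → ∀ γ : ℝ → ℂ, JacobiOrth.IsGammaOne γ →
      ∀ w : ℂ → ℂ, JacobiOrth.IsWeightBranch α β γ w →
        JacobiOrth.OrthogonalBelow γ w n (JacobiOrth.jacobi n α β) ∧
        JacobiOrth.NonorthogonalAt γ w n (JacobiOrth.jacobi n α β) ∧
        JacobiOrth.CharacterizedUpToConstant γ w n (JacobiOrth.jacobi n α β)) ∧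
    (-1 < β → ∀ γ : ℝ → ℂ, JacobiOrth.IsGammaNegOne γ →
      ∀ w : ℂ → ℂ, JacobiOrth.IsWeightBranch α β γ w →
        JacobiOrth.OrthogonalBelow γ w n (JacobiOrth.jacobi n α β) ∧
        JacobiOrth.NonorthogonalAt γ w n (JacobiOrth.jacobi n α β) ∧
        JacobiOrth.CharacterizedUpToConstant γ w n (JacobiOrth.jacobi n α β)) ∧
    (2 * (n : ℝ) + α + β < 0 → ∀ γ : ℝ → ℂ, JacobiOrth.IsGammaInfty γ →
      ∀ w : ℂ → ℂ, JacobiOrth.IsWeightBranch α β γ w →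
        JacobiOrth.OrthogonalBelow γ w n (JacobiOrth.jacobi n α β) ∧
        (2 * (n : ℝ) + α + β < -1 →
          JacobiOrth.NonorthogonalAt γ w n (JacobiOrth.jacobi n α β)) ∧
        (-1 < 2 * (n : ℝ) + α + β →
          JacobiOrth.DivergentAt γ w n (JacobiOrth.jacobi n α β)) ∧
        JacobiOrth.CharacterizedUpToConstant γ w n (JacobiOrth.jacobi n α β)) := by
  have hαZ : ∀ m : ℤ, α ≠ m := fun m h => hα ⟨m, h.symm⟩
  have hβZ : ∀ m : ℤ, β ≠ m := fun m h => hβ ⟨m, h.symm⟩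
  have hαβZ : ∀ m : ℤ, α + β ≠ m := fun m h => hαβ ⟨m, h.symm⟩
  have hαC : ∀ m : ℤ, (α : ℂ) ≠ m := fun m h => hαZ m (by exact_mod_cast h)
  have hβC : ∀ m : ℤ, (β : ℂ) ≠ m := fun m h => hβZ m (by exact_mod_cast h)
  have hαβC : ∀ m : ℤ, (α : ℂ) + β ≠ m := fun m h => hαβZ m (by exact_mod_cast h)
  refine ⟨JacobiOrth.degree_jacobi n hαβC, fun h γ hγ w hw => ?_, fun h γ hγ w hw => ?_,
    fun h γ hγ w hw => ?_⟩
  · have hint := hγ.integralReduces h hβZ hαβZ hw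
    exact ⟨(hint _).orthogonalBelow hαC hβC hαβC, (hint _).nonorthogonalAt hαC hβC hαβC,
      (hint _).characterizedUpToConstant hαC hβC hαβC⟩
  · have hint := hγ.integralReduces h hαZ hαβZ hw
    exact ⟨(hint _).orthogonalBelow hαC hβC hαβC, (hint _).nonorthogonalAt hαC hβC hαβC,
      (hint _).characterizedUpToConstant hαC hβC hαβC⟩
  -- Orthogonality and uniqueness involve degrees below `2 n`; nonorthogonality needs degree `2 n`
  -- as well, hence the stronger bound `2 n + α + β < -1`.
  · have hint := hγ.integralReduces hαZ hβZ hαβZ hw (N := 2 * n) (by push_cast; linarith)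
    refine ⟨hint.orthogonalBelow hαC hβC hαβC, fun h1 => ?_, fun h1 => ?_,
      hint.characterizedUpToConstant hαC hβC hαβC⟩
    · exact (hγ.integralReduces hαZ hβZ hαβZ hw (by push_cast; linarith)).nonorthogonalAt
        hαC hβC hαβC
    · have hn : (0 : ℝ) ≤ n := n.cast_nonneg
      exact hγ.divergentAt hαZ hβZ hαβZ (by linarith) hw h1
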